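/- **Theorem.** Let $n\ge 0$ be an integer, $L=\mathbb{Z}^n$, let $A\in GL(n,\mathbb{Q})$, and let $L'$ be a finite-index subgroup of $L\cap A^{-1}L$; put $L''=A\,L'\leqslant L$. Let $$G(A,L')=\langle L,\ t \mid t\,c\,t^{-1}=A\,c\ \text{ for all } c\in L'\rangle$$ be the HNN-extension of $L$ in which the stable letter $t$ conjugates $L'$ to $L''$ via multiplication by $A$. Suppose that there is a matrix $R\in GL(n,\mathbb{Z})$ such that 1. $R^2=I_n$; 2. $RAR=A^{-1}$; 3. $R\,L'=L''$. Then there are a group $H$ containing $L$ as a subgroup of index $2$ such that every element of $H\setminus L$ acts on $L$ by conjugation as multiplication by $R$, and a group $H'$ containing $L'$ as a subgroup of index $2$ such that every element of $H'\setminus L'$ acts on $L'$ by conjugation as multiplication by $RA$. For any such $H$ and $H'$, let $K=H*_{L'=L'}H'$ be the free product of $H$ and $H'$ amalgamated along the subgroup $L'\leqslant L\leqslant H$ and the subgroup $L'\leqslant H'$. Then: * $G(A,L')$ embeds as a subgroup of index $2$ in $K$, by an embedding that restricts on $L$ to the inclusion $L\leqslant H\leqslant K$; * if $n=2$ and $A$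 is conjugate in $GL(2,\mathbb{R})$ to an element of $SO(2)$, then $K$ is a CAT(0) group, i.e. it acts properly and cocompactly by isometries on a non-empty CAT(0) space. -/

import Mathlib

namespace CommHNN

/-! ### Lattices in `ℚⁿ` -/

/-- The inclusion `ℤⁿ → ℚⁿ`. -/
def castVec (n : ℕ) : (Fin n → ℤ) →+ (Fin n → ℚ) :=
  (Int.castAddHom ℚ).compLeft (Fin n)

/-- Multiplication of column vectors by the matrix `A`. -/
def mulVecHom {n : ℕ} (A : GL (Fin n) ℚ) : (Fin n → ℚ) →+ (Fin n → ℚ) :=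
  (Matrix.mulVecLin (A : Matrix (Fin n) (Fin n) ℚ)).toAddMonoidHom

/-- The map `ℤⁿ → ℚⁿ`, `v ↦ A v`. -/
def latticeMap {n : ℕ} (A : GL (Fin n) ℚ) : (Fin n → ℤ) →+ (Fin n → ℚ) :=
  (mulVecHom A).comp (castVec n)

/-- The matrix `R`, regarded as a matrix with rational entries. -/
def toRat {n : ℕ} (R : GL (Fin n) ℤ) : GL (Fin n) ℚ :=
  Matrix.GeneralLinearGroup.map (Int.castRingHom ℚ) R

/-- The matrix `A`, regarded as a matrix with real entries. -/
noncomputable def toReal {n : ℕ} (A : GL (Fin n) ℚ) : GL (Fin n) ℝ :=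
  Matrix.GeneralLinearGroup.map (algebraMap ℚ ℝ) A

/-- `L ∩ A⁻¹ L` for `L = ℤⁿ`, as a subgroup of `L`: the integer vectors `v` with `A v ∈ ℤⁿ`. -/
def interLattice {n : ℕ} (A : GL (Fin n) ℚ) : AddSubgroup (Fin n → ℤ) :=
  (castVec n).range.comap (latticeMap A)

/-- `A L' ∩ ℤⁿ` as a subgroup of `ℤⁿ`; it is `A L'` as soon as `L' ≤ L ∩ A⁻¹ L`. -/
def imageLattice {n : ℕ} (A : GL (Fin n) ℚ) (L' : AddSubgroup (Fin n → ℤ)) :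
    AddSubgroup (Fin n → ℤ) :=
  (L'.map (latticeMap A)).comap (castVec n)

theorem castVec_injective (n : ℕ) : Function.Injective (castVec n) := by
  intro v w h
  funext i
  have := congrFun h i
  exact_mod_cast (show ((v i : ℤ) : ℚ) = ((w i : ℤ) : ℚ) from this)

theorem mulVecHom_injective {n : ℕ} (A : GL (Fin n) ℚ) : Function.Injective (mulVecHom A) :=
  Matrix.mulVec_injective_of_isUnit A.isUnit

theorem latticeMap_injective {n : ℕ} (A : GL (Fin n) ℚ) : Function.Injective (latticeMap A) :=
  (mulVecHom_injective A).comp (castVec_injective n)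

theorem map_imageLattice {n : ℕ} (A : GL (Fin n) ℚ) {L' : AddSubgroup (Fin n → ℤ)}
    (hL' : L' ≤ interLattice A) :
    (imageLattice A L').map (castVec n) = L'.map (latticeMap A) := by
  refine AddSubgroup.map_comap_eq_self ?_
  rintro _ ⟨v, hv, rfl⟩
  exact hL' hv

/-- The isomorphism `L' → A L'`, `v ↦ A v`. -/
noncomputable def latticeEquiv {n : ℕ} (A : GL (Fin n) ℚ) (L' : AddSubgroup (Fin n → ℤ))
    (hL' : L' ≤ interLattice A) : L' ≃+ imageLattice A L' :=
  (L'.equivMapOfInjective (latticeMap A) (latticeMap_injective A)).trans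
    (((imageLattice A L').equivMapOfInjective (castVec n) (castVec_injective n)).trans
      (AddEquiv.addSubgroupCongr (map_imageLattice A hL'))).symm

theorem castVec_latticeEquiv {n : ℕ} (A : GL (Fin n) ℚ) (L' : AddSubgroup (Fin n → ℤ))
    (hL' : L' ≤ interLattice A) (v : L') :
    castVec n (latticeEquiv A L' hL' v : Fin n → ℤ)
      = (A : Matrix (Fin n) (Fin n) ℚ).mulVec (castVec n (v : Fin n → ℤ)) := by
  set e := ((imageLattice A L').equivMapOfInjective (castVec n) (castVec_injective n)).trans
      (AddEquiv.addSubgroupCongr (map_imageLattice A hL')) with he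
  have h := e.apply_symm_apply (L'.equivMapOfInjective (latticeMap A) (latticeMap_injective A) v)
  exact congrArg Subtype.val h

/-! ### The HNN-extension `G(A, L')` -/

/-- The isomorphism `L' → A L'`, `v ↦ A v`, between subgroups of `L = ℤⁿ` written
multiplicatively. -/
noncomputable def stableEquiv {n : ℕ} (A : GL (Fin n) ℚ) (L' : AddSubgroup (Fin n → ℤ))
    (hL' : L' ≤ interLattice A) :
    AddSubgroup.toSubgroup L' ≃* AddSubgroup.toSubgroup (imageLattice A L') where
  toFun v := ⟨Multiplicative.ofAdd (latticeEquiv A L' hL' ⟨Multiplicative.toAdd v.1, v.2⟩).1,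
    (latticeEquiv A L' hL' ⟨Multiplicative.toAdd v.1, v.2⟩).2⟩
  invFun w := ⟨Multiplicative.ofAdd
      ((latticeEquiv A L' hL').symm ⟨Multiplicative.toAdd w.1, w.2⟩).1,
    ((latticeEquiv A L' hL').symm ⟨Multiplicative.toAdd w.1, w.2⟩).2⟩
  left_inv v := Subtype.ext (congrArg Subtype.val
    ((latticeEquiv A L' hL').symm_apply_apply ⟨Multiplicative.toAdd v.1, v.2⟩))
  right_inv w := Subtype.ext (congrArg Subtype.val
    ((latticeEquiv A L' hL').apply_symm_apply ⟨Multiplicative.toAdd w.1, w.2⟩))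
  map_mul' v w := Subtype.ext (congrArg Subtype.val
    ((latticeEquiv A L' hL').map_add ⟨Multiplicative.toAdd v.1, v.2⟩
      ⟨Multiplicative.toAdd w.1, w.2⟩))

/-- The group `G(A, L') = ⟨ L, t ∥ t c t⁻¹ = A c for all c ∈ L' ⟩`, where `L = ℤⁿ`. -/
abbrev G {n : ℕ} (A : GL (Fin n) ℚ) (L' : AddSubgroup (Fin n → ℤ))
    (hL' : L' ≤ interLattice A) : Type :=
  HNNExtension (Multiplicative (Fin n → ℤ)) (AddSubgroup.toSubgroup L')
    (AddSubgroup.toSubgroup (imageLattice A L')) (stableEquiv A L' hL')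

/-! ### Index-two overgroups -/

/-- `ι` embeds the lattice `V` (with coordinates given by `j : V → ℚⁿ`) as a subgroup of index two
of `H`, and every element of `H` outside `V` acts on `V` by conjugation as multiplication by the
matrix `B`.  Equivalently, `H` is an extension with kernel `V` and quotient of order two, whose
generator acts on `V` as `B`. -/
structure IsIndexTwoOvergroup {n : ℕ} {V : Type} [AddCommGroup V] {H : Type} [Group H]
    (j : V →+ (Fin n → ℚ)) (B : Matrix (Fin n) (Fin n) ℚ) (ι : Multiplicative V →* H) :
    Prop where
  injective : Function.Injective ι
  index_eq : ι.range.index = 2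
  conj : ∀ h : H, h ∉ ι.range → ∀ v : V, ∃ w : V, j w = B.mulVec (j v) ∧
    h * ι (Multiplicative.ofAdd v) * h⁻¹ = ι (Multiplicative.ofAdd w)

/-! ### Amalgamated free products of two groups -/

section Amalgam

/-- The family consisting of the two groups `H` (at `false`) and `H'` (at `true`). -/
def Fam (H H' : Type) : Bool → Type
  | false => H
  | true => H'

instance Fam.instGroup (H H' : Type) [Group H] [Group H'] : ∀ b, Group (Fam H H' b)
  | false => inferInstanceAs (Group H)
  | true => inferInstanceAs (Group H')

/-- The family consisting of the two homomorphisms `f : C → H` and `f' : C → H'`. -/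
def famHom {C H H' : Type} [Group C] [Group H] [Group H'] (f : C →* H) (f' : C →* H') :
    ∀ b, C →* Fam H H' b
  | false => f
  | true => f'

/-- The free product of `H` and `H'` amalgamated along `C` by means of `f : C → H` and
`f' : C → H'`. -/
abbrev Amalgam {C H H' : Type} [Group C] [Group H] [Group H'] (f : C →* H) (f' : C →* H') :
    Type :=
  Monoid.PushoutI (famHom f f')

/-- The canonical homomorphism `H → H *_C H'`. -/
def Amalgam.inl {C H H' : Type} [Group C] [Group H] [Group H'] (f : C →* H) (f' : C →* H') :
    H →* Amalgam f f' :=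
  Monoid.PushoutI.of (φ := famHom f f') false

/-- The canonical homomorphism `H' → H *_C H'`. -/
def Amalgam.inr {C H H' : Type} [Group C] [Group H] [Group H'] (f : C →* H) (f' : C →* H') :
    H' →* Amalgam f f' :=
  Monoid.PushoutI.of (φ := famHom f f') true

end Amalgam

/-- For embeddings `ι : ℤⁿ → H` and `ι' : L' → H'`, with `L' ≤ ℤⁿ`, the amalgamated free product
`H *_{L' = L'} H'`. -/
abbrev K {n : ℕ} {L' : AddSubgroup (Fin n → ℤ)} {H H' : Type} [Group H] [Group H']
    (ι : Multiplicative (Fin n → ℤ) →* H) (ι' : Multiplicative L' →* H') : Type :=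
  Amalgam (ι.comp (AddMonoidHom.toMultiplicative L'.subtype)) ι'

/-! ### CAT(0) spaces and CAT(0) groups -/

/-- `γ` restricts to a geodesic from `x` to `y`, i.e. to an isometric embedding of the interval
`[0, dist x y]` that starts at `x` and ends at `y`. -/
structure IsGeodesic {X : Type} [MetricSpace X] (γ : ℝ → X) (x y : X) : Prop where
  source : γ 0 = x
  target : γ (dist x y) = y
  isometry : ∀ s ∈ Set.Icc 0 (dist x y), ∀ t ∈ Set.Icc 0 (dist x y),
    dist (γ s) (γ t) = |s - t|

/-- A CAT(0) space: a geodesic metric space in which every geodesic triangle is at least as thin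
as its comparison triangle in the Euclidean plane.  In the triangle with vertices `p`, `q`, `r`
the two points that are compared lie on the sides `α` and `β` that meet in `p`; the names of the
vertices are arbitrary, and two points on the same side have the same distance as their comparison
points. -/
structure IsCAT0Space (X : Type) [MetricSpace X] : Prop where
  geodesic : ∀ x y : X, ∃ γ : ℝ → X, IsGeodesic γ x y
  thin : ∀ (p q r : X) (α β : ℝ → X), IsGeodesic α p q → IsGeodesic β p r →
    ∀ p' q' r' : EuclideanSpace ℝ (Fin 2),
      dist p' q' = dist p q → dist p' r' = dist p r → dist q' r' = dist q r →
    ∀ s ∈ Set.Icc 0 (dist p q), ∀ t ∈ Set.Icc 0 (dist p r),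
    ∀ x' ∈ segment ℝ p' q', ∀ y' ∈ segment ℝ p' r', dist p' x' = s → dist p' y' = t →
      dist (α s) (β t) ≤ dist x' y'

/-- A group acts geometrically on a metric space if it acts by isometries, properly (every point
has a ball that meets only finitely many of its translates) and cocompactly. -/
structure IsGeometricAction (Γ X : Type) [Group Γ] [MetricSpace X] [MulAction Γ X] : Prop where
  isometric : ∀ (g : Γ) (x y : X), dist (g • x) (g • y) = dist x y
  proper : ∀ x : X, ∃ ε > 0,
    {g : Γ | ∃ y ∈ Metric.ball x ε, g • y ∈ Metric.ball x ε}.Finite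
  cocompact : ∃ C : Set X, IsCompact C ∧ ∀ x : X, ∃ g : Γ, ∃ c ∈ C, g • c = x

/-- A CAT(0) group: a group that acts geometrically on a (non-empty) CAT(0) space. -/
def IsCAT0Group (Γ : Type) [Group Γ] : Prop :=
  ∃ (X : Type) (_ : MetricSpace X) (_ : MulAction Γ X),
    Nonempty X ∧ IsCAT0Space X ∧ IsGeometricAction Γ X

end CommHNN

/-!
If `h ∈ H` and `h' ∈ H'` lie outside `L` and `L'`, then `h * h'` acts on `L'` in `K` as
multiplication by `R * (R * A) = A`, so that the inclusion of `L` extends to a homomorphism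
`G → K` with `t ↦ h * h'`.  Conversely, `K` is recovered from `G` by adjoining a square root `u`
of `h * h ∈ L` that acts on `L` as `R` and conjugates `t` to `(h * h) * (h' * h') * t⁻¹`: the
universal properties of both groups give mutually inverse homomorphisms with `u ↔ h` and
`u⁻¹ * t ↔ h'`, and so `G` has index two in `K`.

Suppose now that `A` preserves an inner product on `ℝⁿ`.  Averaging it over the involution `R`
makes both `R` and `R * A` isometries of a Euclidean space `E`.  Composing them with the
translations by half of `h * h` and half of `h' * h'` extends the translation actions of `L` and
`L'` to `H` and `H'`, hence to `K`.  The other factor is the Bass–Serre tree of the amalgam,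
constructed metrically: by the normal form theorem, the word metric on `K / L'` satisfies the
four-point condition, and so it spans a real tree.  Since `L'` has finite index in `L` and acts on
`E` as a lattice, the diagonal action of `K` on the product of the tree with `E` is geometric.
-/

namespace CommHNN

/-! ### The CN inequality -/

section CN

variable {X Y : Type*} [PseudoMetricSpace X] [PseudoMetricSpace Y]

/-- The inequality of Bruhat and Tits, which characterizes the point `m` that divides the segment
from `y` to `z` in the ratio `t : 1 - t`; the CN inequality proper is the case `t = 1 / 2`. -/
def IsCNPoint (t : ℝ) (y z m : X) : Prop :=
  ∀ x, dist x m ^ 2 ≤ (1 - t) * dist x y ^ 2 + t * dist x z ^ 2 - t * (1 - t) * dist y z ^ 2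

variable (X) in
/-- Every pair of points has a point satisfying the Bruhat–Tits inequality for each ratio.  For
metric spaces this implies CAT(0), and unlike CAT(0) it makes sense for pseudometrics. -/
def HasCN : Prop :=
  ∀ y z : X, ∀ t ∈ Set.Icc (0 : ℝ) 1, ∃ m, IsCNPoint t y z m

namespace IsCNPoint

variable {s t : ℝ} {y z m m' : X}

theorem left (y z : X) : IsCNPoint 0 y z y := fun x => by simp

theorem right (y z : X) : IsCNPoint 1 y z z := fun x => by simp

theorem dist_left_le (h : IsCNPoint t y z m) (ht : 0 ≤ t) : dist y m ≤ t * dist y z := by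
  refine abs_le_of_sq_le_sq' ?_ (by positivity) |>.2
  calc dist y m ^ 2 ≤ _ := h y
    _ = (t * dist y z) ^ 2 := by rw [dist_self]; ring

theorem dist_right_le (h : IsCNPoint t y z m) (ht : t ≤ 1) : dist m z ≤ (1 - t) * dist y z := by
  refine abs_le_of_sq_le_sq' ?_ (mul_nonneg (sub_nonneg.2 ht) dist_nonneg) |>.2
  calc dist m z ^ 2 = dist z m ^ 2 := by rw [dist_comm]
    _ ≤ _ := h z
    _ = ((1 - t) * dist y z) ^ 2 := by rw [dist_self, dist_comm z y]; ring

theorem dist_eq_of_le (h : IsCNPoint s y z m) (h' : IsCNPoint t y z m') (hs : 0 ≤ s)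
    (hst : s ≤ t) (ht : t ≤ 1) : dist m m' = (t - s) * dist y z := by
  have hleft := h.dist_left_le hs
  have hright := h.dist_right_le (hst.trans ht)
  apply le_antisymm
  · refine abs_le_of_sq_le_sq' ?_ (mul_nonneg (sub_nonneg.2 hst) dist_nonneg) |>.2
    have hy : dist m y ^ 2 ≤ (s * dist y z) ^ 2 := by rw [dist_comm m y]; gcongr
    have hz : dist m z ^ 2 ≤ ((1 - s) * dist y z) ^ 2 := by gcongr
    calc dist m m' ^ 2
        ≤ (1 - t) * dist m y ^ 2 + t * dist m z ^ 2 - t * (1 - t) * dist y z ^ 2 := h' m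
      _ ≤ (1 - t) * (s * dist y z) ^ 2 + t * ((1 - s) * dist y z) ^ 2
            - t * (1 - t) * dist y z ^ 2 := by
          have := sub_nonneg.2 ht
          have := hs.trans hst
          gcongr
      _ = ((t - s) * dist y z) ^ 2 := by ring
  · linarith [dist_triangle4 y m m' z, h'.dist_right_le ht]

theorem dist_eq (h : IsCNPoint s y z m) (h' : IsCNPoint t y z m') (hs : s ∈ Set.Icc 0 1)
    (ht : t ∈ Set.Icc 0 1) : dist m m' = |s - t| * dist y z := by
  rcases le_total s t with hst | hts
  · rw [h.dist_eq_of_le h' hs.1 hst ht.2, abs_sub_comm, abs_of_nonneg (sub_nonneg.2 hst)]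
  · rw [dist_comm, h'.dist_eq_of_le h ht.1 hts hs.2, abs_of_nonneg (sub_nonneg.2 hts)]

theorem dist_sq_le {p q r x x' : X} (hx : IsCNPoint s p q x) (hx' : IsCNPoint t p r x')
    (hs : s ∈ Set.Icc 0 1) (ht : 0 ≤ t) :
    dist x x' ^ 2
      ≤ s * (s - t) * dist p q ^ 2 + t * (t - s) * dist p r ^ 2 + s * t * dist q r ^ 2 := by
  have hpx : dist x p = s * dist p q := by
    rw [dist_comm, (left p q).dist_eq_of_le hx le_rfl hs.1 hs.2, sub_zero]
  have hrx : dist x r ^ 2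
      ≤ (1 - s) * dist p r ^ 2 + s * dist q r ^ 2 - s * (1 - s) * dist p q ^ 2 := by
    simpa only [dist_comm r] using hx r
  calc dist x x' ^ 2
      ≤ (1 - t) * dist x p ^ 2 + t * dist x r ^ 2 - t * (1 - t) * dist p r ^ 2 := hx' x
    _ ≤ (1 - t) * (s * dist p q) ^ 2
          + t * ((1 - s) * dist p r ^ 2 + s * dist q r ^ 2 - s * (1 - s) * dist p q ^ 2)
          - t * (1 - t) * dist p r ^ 2 := by rw [hpx]; gcongr
    _ = _ := by ring

end IsCNPoint

theorem HasCN.separationQuotient (h : HasCN X) : HasCN (SeparationQuotient X) := by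
  intro y z t ht
  obtain ⟨y, rfl⟩ := SeparationQuotient.surjective_mk y
  obtain ⟨z, rfl⟩ := SeparationQuotient.surjective_mk z
  obtain ⟨m, hm⟩ := h y z t ht
  refine ⟨SeparationQuotient.mk m, fun x => ?_⟩
  obtain ⟨x, rfl⟩ := SeparationQuotient.surjective_mk x
  simpa only [SeparationQuotient.dist_mk] using hm x

theorem withLp_prod_dist_sq (u v : WithLp 2 (X × Y)) :
    dist u v ^ 2 = dist u.fst v.fst ^ 2 + dist u.snd v.snd ^ 2 := by
  rw [WithLp.prod_dist_eq_add (by norm_num), ENNReal.toReal_ofNat, ← Real.sqrt_eq_rpow,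
    Real.rpow_two, Real.rpow_two, Real.sq_sqrt (by positivity)]

theorem HasCN.prod (hX : HasCN X) (hY : HasCN Y) : HasCN (WithLp 2 (X × Y)) := by
  intro y z t ht
  obtain ⟨m, hm⟩ := hX y.fst z.fst t ht
  obtain ⟨n, hn⟩ := hY y.snd z.snd t ht
  refine ⟨WithLp.toLp 2 (m, n), fun x => ?_⟩
  simp only [withLp_prod_dist_sq, WithLp.toLp_fst, WithLp.toLp_snd]
  linarith [hm x.fst, hn x.snd]

end CN

section InnerProductSpace

variable {E : Type*} [NormedAddCommGroup E] [InnerProductSpace ℝ E]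

theorem dist_sq_lineMap (x y z : E) (t : ℝ) :
    dist x (AffineMap.lineMap y z t) ^ 2
      = (1 - t) * dist x y ^ 2 + t * dist x z ^ 2 - t * (1 - t) * dist y z ^ 2 := by
  have hsub : x - AffineMap.lineMap y z t = (1 - t) • (x - y) + t • (x - z) := by
    rw [AffineMap.lineMap_apply_module]; module
  have hyz : y - z = (x - z) - (x - y) := by abel
  simp only [dist_eq_norm, hsub, hyz, norm_add_sq_real, norm_sub_sq_real (x - z), norm_smul,
    mul_pow, real_inner_smul_right, Real.norm_eq_abs, sq_abs,
    real_inner_comm (x - z)]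
  ring

theorem hasCN_of_innerProductSpace : HasCN E :=
  fun y z t _ => ⟨AffineMap.lineMap y z t, fun x => (dist_sq_lineMap x y z t).le⟩

theorem dist_sq_lineMap_lineMap (p q r : E) (s t : ℝ) :
    dist (AffineMap.lineMap p q s) (AffineMap.lineMap p r t) ^ 2
      = s * (s - t) * dist p q ^ 2 + t * (t - s) * dist p r ^ 2 + s * t * dist q r ^ 2 := by
  have hp : dist (AffineMap.lineMap p q s) p ^ 2 = s ^ 2 * dist p q ^ 2 := by
    rw [dist_lineMap_left, mul_pow, Real.norm_eq_abs, sq_abs]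
  rw [dist_sq_lineMap, hp, dist_comm _ r, dist_sq_lineMap, dist_comm r p, dist_comm r q]
  ring

end InnerProductSpace

section CAT0

variable {X : Type} [MetricSpace X]

theorem IsCNPoint.eq {t : ℝ} {y z m m' : X} (h : IsCNPoint t y z m) (h' : IsCNPoint t y z m')
    (ht : t ∈ Set.Icc 0 1) : m = m' :=
  dist_eq_zero.1 (by rw [h.dist_eq h' ht ht, sub_self, abs_zero, zero_mul])

theorem HasCN.exists_isGeodesic (h : HasCN X) (x y : X) : ∃ γ : ℝ → X, IsGeodesic γ x y := by
  have hratio : ∀ s ∈ Set.Icc 0 (dist x y), s / dist x y ∈ Set.Icc (0 : ℝ) 1 := fun s hs =>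
    ⟨div_nonneg hs.1 dist_nonneg, div_le_one_of_le₀ hs.2 dist_nonneg⟩
  have hmul : ∀ s ∈ Set.Icc 0 (dist x y), s / dist x y * dist x y = s := by
    intro s hs
    refine div_mul_cancel_of_imp fun hxy => ?_
    rw [hxy] at hs
    exact le_antisymm hs.2 hs.1
  have hpoint : ∀ s : ℝ, ∃ m, s ∈ Set.Icc 0 (dist x y) → IsCNPoint (s / dist x y) x y m := by
    intro s
    by_cases hs : s ∈ Set.Icc 0 (dist x y)
    · exact (h x y _ (hratio s hs)).imp fun _ hm _ => hm
    · exact ⟨x, fun hs' => absurd hs' hs⟩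
  choose γ hγ using hpoint
  have hzero : (0 : ℝ) ∈ Set.Icc 0 (dist x y) := ⟨le_rfl, dist_nonneg⟩
  have hdist : dist x y ∈ Set.Icc 0 (dist x y) := ⟨dist_nonneg, le_rfl⟩
  refine ⟨γ, ?_, ?_, fun s hs t ht => ?_⟩
  · have hsource := hγ 0 hzero
    rw [zero_div] at hsource
    exact hsource.eq (.left x y) ⟨le_rfl, zero_le_one⟩
  · have htarget := (hγ _ hdist).dist_right_le (hratio _ hdist).2
    rw [sub_mul, hmul _ hdist, one_mul, sub_self] at htarget
    exact dist_le_zero.1 htarget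
  · rw [(hγ s hs).dist_eq (hγ t ht) (hratio s hs) (hratio t ht), ← abs_of_nonneg (a := dist x y)
      dist_nonneg, ← abs_mul, sub_mul, abs_of_nonneg (a := dist x y) dist_nonneg, hmul s hs,
      hmul t ht]

theorem HasCN.isCNPoint_of_dist_eq (h : HasCN X) {t : ℝ} {y z m : X} (ht : t ∈ Set.Icc 0 1)
    (hy : dist m y = t * dist y z) (hz : dist m z = (1 - t) * dist y z) : IsCNPoint t y z m := by
  obtain ⟨m', hm'⟩ := h y z t ht
  have hle := hm' m
  rw [hy, hz] at hle
  have hsq : dist m m' ^ 2 = 0 := le_antisymm (hle.trans_eq (by ring)) (sq_nonneg _)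
  rwa [dist_eq_zero.1 (pow_eq_zero_iff two_ne_zero |>.1 hsq)]

theorem HasCN.isCNPoint_of_isGeodesic (h : HasCN X) {y z : X} {γ : ℝ → X}
    (hγ : IsGeodesic γ y z) {t : ℝ} (ht : t ∈ Set.Icc 0 1) :
    IsCNPoint t y z (γ (t * dist y z)) := by
  have hzero : (0 : ℝ) ∈ Set.Icc 0 (dist y z) := ⟨le_rfl, dist_nonneg⟩
  have hdist : dist y z ∈ Set.Icc 0 (dist y z) := ⟨dist_nonneg, le_rfl⟩
  have hmem : t * dist y z ∈ Set.Icc 0 (dist y z) :=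
    ⟨mul_nonneg ht.1 dist_nonneg, mul_le_of_le_one_left dist_nonneg ht.2⟩
  have hsource := hγ.isometry _ hmem _ hzero
  have htarget := hγ.isometry _ hmem _ hdist
  rw [hγ.source, sub_zero, abs_of_nonneg hmem.1] at hsource
  rw [hγ.target, abs_sub_comm, abs_of_nonneg (sub_nonneg.2 hmem.2)] at htarget
  exact h.isCNPoint_of_dist_eq ht hsource (by rw [htarget]; ring)

theorem HasCN.isCAT0Space (h : HasCN X) : IsCAT0Space X where
  geodesic := h.exists_isGeodesic
  thin := by
    intro p q r α β hα hβ p' q' r' hpq hpr hqr s _ t _ x' hx' y' hy' hsx hty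
    rw [segment_eq_image_lineMap] at hx' hy'
    obtain ⟨a, ha, rfl⟩ := hx'
    obtain ⟨b, hb, rfl⟩ := hy'
    rw [dist_left_lineMap, Real.norm_of_nonneg ha.1, hpq] at hsx
    rw [dist_left_lineMap, Real.norm_of_nonneg hb.1, hpr] at hty
    subst hsx hty
    refine abs_le_of_sq_le_sq' ?_ dist_nonneg |>.2
    rw [dist_sq_lineMap_lineMap, hpq, hpr, hqr]
    exact (h.isCNPoint_of_isGeodesic hα ha).dist_sq_le (h.isCNPoint_of_isGeodesic hβ hb) ha hb.1

end CAT0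

/-! ### The tree spanned by a `0`-hyperbolic space -/

/-- A `0`-hyperbolic pseudometric: one that satisfies the four-point condition. -/
structure IsTreeMetric {V : Type*} (d : V → V → ℝ) : Prop where
  self : ∀ x, d x x = 0
  symm : ∀ x y, d x y = d y x
  four_point : ∀ x y z w, d x y + d z w ≤ max (d x z + d y w) (d x w + d y z)

theorem IsTreeMetric.triangle {V : Type*} {d : V → V → ℝ} (hd : IsTreeMetric d) (x y z : V) :
    d x z ≤ d x y + d y z := by
  have := hd.four_point x z y y
  rw [hd.self, max_self, hd.symm z y] at this
  linarith

/-- A point of the real tree spanned by a `0`-hyperbolic space: it lies on the segment from the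
vertex `fst` to the vertex `snd`, at distance `a` from `fst` and `b` from `snd`.  Different data
may describe the same point, so that the tree itself is the separation quotient. -/
structure TreePoint {V : Type*} {d : V → V → ℝ} (hd : IsTreeMetric d) where
  fst : V
  snd : V
  a : ℝ
  b : ℝ
  a_nonneg : 0 ≤ a
  b_nonneg : 0 ≤ b
  add_eq : a + b = d fst snd

namespace TreePoint

variable {V : Type*} {d : V → V → ℝ} {hd : IsTreeMetric d}

/-- The distance from a point of the tree to a vertex. -/
def toVertex (x : TreePoint hd) (w : V) : ℝ :=
  max (d x.fst w - x.a) (d x.snd w - x.b)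

noncomputable instance : Dist (TreePoint hd) where
  dist x y := max (y.toVertex x.fst - x.a) (y.toVertex x.snd - x.b)

theorem dist_def (x y : TreePoint hd) :
    dist x y = max (y.toVertex x.fst - x.a) (y.toVertex x.snd - x.b) :=
  rfl

theorem dist_eq (x y : TreePoint hd) : dist x y =
    max (max (d x.fst y.fst - x.a - y.a) (d x.fst y.snd - x.a - y.b))
      (max (d x.snd y.fst - x.b - y.a) (d x.snd y.snd - x.b - y.b)) := by
  simp only [dist_def, toVertex, hd.symm y.fst, hd.symm y.snd, ← max_sub_sub_right,
    sub_right_comm]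

theorem toVertex_fst (x : TreePoint hd) : x.toVertex x.fst = x.a := by
  have := x.a_nonneg
  rw [toVertex, hd.self, hd.symm, ← x.add_eq, max_eq_right] <;> linarith

theorem toVertex_snd (x : TreePoint hd) : x.toVertex x.snd = x.b := by
  have := x.b_nonneg
  rw [toVertex, hd.self, ← x.add_eq, max_eq_left] <;> linarith

theorem dist_self' (x : TreePoint hd) : dist x x = 0 := by
  rw [dist_def, toVertex_fst, toVertex_snd, sub_self, sub_self, max_self]

theorem dist_comm' (x y : TreePoint hd) : dist x y = dist y x := by
  rw [dist_eq, dist_eq, hd.symm y.fst, hd.symm y.fst, hd.symm y.snd, hd.symm y.snd,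
    max_max_max_comm]
  simp only [sub_right_comm]

theorem max_sub_add_le {a b p q r p' q' r' A B C : ℝ}
    (h : p + A ≤ max (q + B) (r + C)) (h' : p' + A ≤ max (q' + B) (r' + C)) :
    max (p - a) (p' - b) + A ≤ max (max (q - a) (q' - b) + B) (max (r - a) (r' - b) + C) := by
  grind

-- The four-point condition passes from vertices to points one argument at a time: both `toVertex`
-- and `dist` are maxima of two shifted terms, so `max_sub_add_le` applies at each step.

theorem toVertex_add_vertexDist_le (x : TreePoint hd) (u v w : V) :
    x.toVertex u + d v w ≤ max (x.toVertex v + d u w) (x.toVertex w + d u v) :=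
  max_sub_add_le (hd.four_point _ u v w) (hd.four_point _ u v w)

theorem toVertex_add_toVertex_le (x y : TreePoint hd) (u v : V) :
    x.toVertex u + y.toVertex v ≤ max (dist x y + d u v) (x.toVertex v + y.toVertex u) := by
  have key (w : V) : d w u + y.toVertex v ≤ max (y.toVertex w + d u v) (d w v + y.toVertex u) := by
    have := toVertex_add_vertexDist_le y v u w
    rw [hd.symm v w, hd.symm v u, hd.symm u w] at this
    rw [add_comm, max_comm]
    rwa [add_comm (y.toVertex u)] at this
  exact max_sub_add_le (key _) (key _)

theorem dist_add_toVertex_le (x y z : TreePoint hd) (w : V) :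
    dist x y + z.toVertex w ≤ max (dist x z + y.toVertex w) (x.toVertex w + dist y z) := by
  have key (u : V) : y.toVertex u + z.toVertex w ≤
      max (z.toVertex u + y.toVertex w) (d u w + dist y z) := by
    have := toVertex_add_toVertex_le y z u w
    rw [max_comm, add_comm (dist y z)] at this
    rwa [add_comm (z.toVertex u)]
  exact max_sub_add_le (key _) (key _)

theorem four_point (x y z w : TreePoint hd) :
    dist x y + dist z w ≤ max (dist x z + dist y w) (dist x w + dist y z) := by
  have key (u : V) : y.toVertex u + dist z w ≤
      max (z.toVertex u + dist y w) (w.toVertex u + dist y z) := by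
    have := dist_add_toVertex_le z w y u
    rw [dist_comm' z y, dist_comm' w y] at this
    rwa [add_comm, max_comm, add_comm (w.toVertex u)]
  exact max_sub_add_le (key _) (key _)

noncomputable instance : PseudoMetricSpace (TreePoint hd) where
  dist_self := dist_self'
  dist_comm := dist_comm'
  dist_triangle := IsTreeMetric.triangle ⟨dist_self', dist_comm', four_point⟩

/-- A vertex as a point of the tree. -/
def ofVertex (w : V) : TreePoint hd := ⟨w, w, 0, 0, le_rfl, le_rfl, by rw [hd.self, add_zero]⟩

theorem dist_ofVertex (x : TreePoint hd) (w : V) : dist x (ofVertex w) = x.toVertex w := by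
  simp only [dist_def, toVertex, ofVertex, sub_zero, max_self, hd.symm w]

theorem dist_eq_zero_of_toVertex_le {x y : TreePoint hd} (hfst : y.toVertex x.fst ≤ x.a)
    (hsnd : y.toVertex x.snd ≤ x.b) : dist x y = 0 :=
  le_antisymm (max_le (sub_nonpos.2 hfst) (sub_nonpos.2 hsnd)) dist_nonneg

theorem toVertex_le (x y : TreePoint hd) (w : V) : x.toVertex w ≤ dist x y + y.toVertex w := by
  simpa only [dist_ofVertex] using dist_triangle x y (ofVertex w)

theorem toVertex_nonneg (x : TreePoint hd) (w : V) : 0 ≤ x.toVertex w :=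
  dist_ofVertex x w ▸ dist_nonneg

theorem exists_dist_eq (x y : TreePoint hd) :
    ∃ p q : V, dist x y = d p q - x.toVertex p - y.toVertex q := by
  have hvertex (z : TreePoint hd) (w : V) :
      ∃ q, z.toVertex w = d w q - z.toVertex q := by
    rcases max_choice (d z.fst w - z.a) (d z.snd w - z.b) with h | h
    · exact ⟨z.fst, by rw [toVertex_fst, hd.symm w, ← h, toVertex]⟩
    · exact ⟨z.snd, by rw [toVertex_snd, hd.symm w, ← h, toVertex]⟩
  rcases max_choice (y.toVertex x.fst - x.a) (y.toVertex x.snd - x.b) with h | h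
  · obtain ⟨q, hq⟩ := hvertex y x.fst
    exact ⟨x.fst, q, by rw [dist_def, h, hq, toVertex_fst, sub_right_comm]⟩
  · obtain ⟨q, hq⟩ := hvertex y x.snd
    exact ⟨x.snd, q, by rw [dist_def, h, hq, toVertex_snd, sub_right_comm]⟩

theorem exists_between (x y : TreePoint hd) {r s : ℝ} (hr : 0 ≤ r) (hs : 0 ≤ s)
    (hrs : r + s = dist x y) : ∃ m : TreePoint hd, dist x m ≤ r ∧ dist y m ≤ s := by
  obtain ⟨p, q, hpq⟩ := exists_dist_eq x y
  refine ⟨⟨p, q, x.toVertex p + r, s + y.toVertex q, add_nonneg (toVertex_nonneg x p) hr,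
    add_nonneg hs (toVertex_nonneg y q), by linarith⟩, ?_, ?_⟩
  · have := toVertex_le x y q
    rw [dist_comm]
    exact max_le (by dsimp only; linarith) (by dsimp only; linarith)
  · have := toVertex_le y x p
    rw [dist_comm] at this
    rw [dist_comm]
    exact max_le (by dsimp only; linarith) (by dsimp only; linarith)

theorem isCNPoint_of_dist_le {y z m : TreePoint hd} {t : ℝ} (ht : t ∈ Set.Icc 0 1)
    (hy : dist m y ≤ t * dist y z) (hz : dist m z ≤ (1 - t) * dist y z) : IsCNPoint t y z m := by
  intro x
  have hsq_xy : (dist x z - dist y z) ^ 2 ≤ dist x y ^ 2 :=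
    sq_le_sq' (by linarith [dist_triangle_left y z x]) (by linarith [dist_triangle x y z])
  have hsq_xz : (dist x y - dist y z) ^ 2 ≤ dist x z ^ 2 :=
    sq_le_sq' (by linarith [dist_triangle_left y z x]) (by linarith [dist_triangle_right x y z])
  rcases le_max_iff.1 (four_point x m y z) with h | h
  · calc dist x m ^ 2 ≤ (dist x y - t * dist y z) ^ 2 :=
          pow_le_pow_left₀ dist_nonneg (by linarith) 2
      _ ≤ _ := by linarith [mul_le_mul_of_nonneg_left hsq_xz ht.1]
  · calc dist x m ^ 2 ≤ (dist x z - (1 - t) * dist y z) ^ 2 :=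
          pow_le_pow_left₀ dist_nonneg (by linarith) 2
      _ ≤ _ := by linarith [mul_le_mul_of_nonneg_left hsq_xy (sub_nonneg.2 ht.2)]

theorem hasCN : HasCN (TreePoint hd) := by
  intro y z t ht
  obtain ⟨m, hy, hz⟩ := exists_between y z (mul_nonneg ht.1 dist_nonneg)
    (mul_nonneg (sub_nonneg.2 ht.2) dist_nonneg) (r := t * dist y z) (s := (1 - t) * dist y z)
    (by ring)
  exact ⟨m, isCNPoint_of_dist_le ht (by rwa [dist_comm]) (by rwa [dist_comm])⟩

end TreePoint

/-! ### Reduced forms in amalgamated products -/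

section ReducedForm

variable {ι K : Type*} [Group K]

/-- `ReducedForm S C g l` means that `g` is a product of elements of the subgroups `S i` and of an
element of `C`, where the former elements do not lie in `C` and where `l` is the list of their
indices, in which neighbours are distinct. -/
inductive ReducedForm (S : ι → Subgroup K) (C : Subgroup K) : K → List ι → Prop
  | of_mem {c : K} (hc : c ∈ C) : ReducedForm S C c []
  | cons {i : ι} {x g : K} {l : List ι} (hx : x ∈ S i) (hxC : x ∉ C) (hl : l.head? ≠ some i)
      (hg : ReducedForm S C g l) : ReducedForm S C (x * g) (i :: l)

/-- `K` is the free product of the subgroups `S i` amalgamated along `C`.  The normal form theorem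
is used as the definition: a reduced form with at least one factor outside `C` is not trivial. -/
structure IsAmalgam (S : ι → Subgroup K) (C : Subgroup K) : Prop where
  le : ∀ i, C ≤ S i
  iSup_eq_top : ⨆ i, S i = ⊤
  eq_nil : ∀ l, ReducedForm S C 1 l → l = []

variable {S : ι → Subgroup K} {C : Subgroup K}

namespace ReducedForm

theorem mul_left (hA : IsAmalgam S C) {c g : K} {l : List ι} (hc : c ∈ C)
    (hg : ReducedForm S C g l) : ReducedForm S C (c * g) l := by
  cases hg with
  | of_mem h => exact .of_mem (C.mul_mem hc h)
  | @cons i x g l hx hxC hl hg =>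
    rw [← mul_assoc]
    exact .cons ((S i).mul_mem (hA.le i hc) hx) (fun h => hxC ((C.mul_mem_cancel_left hc).1 h)) hl
      hg

theorem exists_mul (hA : IsAmalgam S C) {i : ι} {x g : K} {l : List ι} (hx : x ∈ S i)
    (hg : ReducedForm S C g l) : ∃ m, ReducedForm S C (x * g) m ∧ m.length ≤ l.length + 1 := by
  by_cases hxC : x ∈ C
  · exact ⟨l, hg.mul_left hA hxC, by omega⟩
  cases hg with
  | of_mem h => exact ⟨[i], .cons hx hxC (by simp) (.of_mem h), le_rfl⟩
  | @cons j y g l hy hyC hl hg =>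
    by_cases hij : j = i
    · subst hij
      rw [← mul_assoc]
      by_cases hxy : x * y ∈ C
      · exact ⟨l, hg.mul_left hA hxy, by rw [List.length_cons]; omega⟩
      · exact ⟨j :: l, .cons ((S j).mul_mem hx hy) hxy hl hg, by simp⟩
    · exact ⟨i :: j :: l, .cons hx hxC (by simpa using hij) (.cons hy hyC hl hg), le_rfl⟩

theorem exists_form (hA : IsAmalgam S C) (g : K) : ∃ l, ReducedForm S C g l := by
  suffices ∀ h l, ReducedForm S C h l → ∃ m, ReducedForm S C (g * h) m by
    simpa using this 1 [] (.of_mem C.one_mem)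
  have hg : g ∈ ⨆ i, S i := hA.iSup_eq_top ▸ Subgroup.mem_top g
  induction hg using Subgroup.iSup_induction' with
  | hp i x hx =>
    intro h l hl
    obtain ⟨m, hm, -⟩ := hl.exists_mul hA hx
    exact ⟨m, hm⟩
  | h1 => exact fun h l hl => ⟨l, by rwa [one_mul]⟩
  | hmul x y _ _ hx hy =>
    intro h l hl
    obtain ⟨m, hm⟩ := hy h l hl
    rw [mul_assoc]
    exact hx _ m hm

theorem inv_mul (hA : IsAmalgam S C) {g : K} {l : List ι} (hg : ReducedForm S C g l) :
    ∀ {h : K} {m : List ι}, ReducedForm S C h m → (∀ i, l.head? = some i → m.head? ≠ some i) →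
      ReducedForm S C (g⁻¹ * h) (l.reverse ++ m) := by
  induction hg with
  | of_mem hc => exact fun hh _ => hh.mul_left hA (C.inv_mem hc)
  | @cons i x g l hx hxC hl _ ih =>
    intro h m hh hm
    have hxh : ReducedForm S C (x⁻¹ * h) (i :: m) :=
      .cons ((S i).inv_mem hx) (fun h => hxC (C.inv_mem_iff.1 h)) (hm i rfl) hh
    simpa [mul_assoc] using ih hxh (fun j hj hij => hl (hj.trans hij.symm))

theorem inv_mul_of_ne (hA : IsAmalgam S C) {g h : K} {i j : ι} {l m : List ι} (hij : i ≠ j)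
    (hg : ReducedForm S C g (i :: l)) (hh : ReducedForm S C h (j :: m)) :
    ReducedForm S C (g⁻¹ * h) ((i :: l).reverse ++ j :: m) :=
  hg.inv_mul hA hh (by simpa using hij.symm)

theorem mul_inv_mul (hA : IsAmalgam S C) {i : ι} {x y g h : K} {l m : List ι} (hx : x ∈ S i)
    (hy : y ∈ S i) (hxy : x⁻¹ * y ∉ C) (hg : ReducedForm S C g l) (hl : l.head? ≠ some i)
    (hh : ReducedForm S C h m) (hm : m.head? ≠ some i) :
    ReducedForm S C ((x * g)⁻¹ * (y * h)) (l.reverse ++ i :: m) := by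
  have hxyh : ReducedForm S C (x⁻¹ * y * h) (i :: m) :=
    .cons ((S i).mul_mem ((S i).inv_mem hx) hy) hxy hm hh
  simpa [mul_assoc] using hg.inv_mul hA hxyh (fun j hj hij => hl (hj.trans hij.symm))

theorem eq_nil_of_mem (hA : IsAmalgam S C) {c : K} {l : List ι} (hc : c ∈ C)
    (hl : ReducedForm S C c l) : l = [] :=
  hA.eq_nil l (by simpa using hl.mul_left hA (C.inv_mem hc))

theorem unique (hA : IsAmalgam S C) {g : K} {l : List ι} (hg : ReducedForm S C g l) :
    ∀ {m : List ι}, ReducedForm S C g m → l = m := by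
  induction hg with
  | of_mem hc => exact fun hm => (hm.eq_nil_of_mem hA hc).symm
  | @cons i x g l hx hxC hl hg ih =>
    intro m hm
    have hxg := ReducedForm.cons hx hxC hl hg
    generalize hk : x * g = k at hm hxg
    cases hm with
    | of_mem hc => exact hxg.eq_nil_of_mem hA hc
    | @cons j y h m hy hyC hm hh =>
      by_cases hij : i = j
      · subst hij
        by_cases hxy : x⁻¹ * y ∈ C
        · have := hh.mul_left hA hxy
          rw [mul_assoc, ← hk, inv_mul_cancel_left] at this
          rw [ih this]
        · have := mul_inv_mul hA hx hy hxy hg hl hh hm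
          rw [hk, inv_mul_cancel] at this
          simpa using hA.eq_nil _ this
      · have := hxg.inv_mul_of_ne hA hij (.cons hy hyC hm hh)
        rw [inv_mul_cancel] at this
        simpa using hA.eq_nil _ this

end ReducedForm

variable (S C) in
/-- The number of factors outside `C` in a reduced form. -/
noncomputable def reducedLength (g : K) : ℕ :=
  sInf {n | ∃ l, ReducedForm S C g l ∧ l.length = n}

theorem ReducedForm.length_eq (hA : IsAmalgam S C) {g : K} {l : List ι}
    (hg : ReducedForm S C g l) : reducedLength S C g = l.length := by
  have : {n | ∃ l, ReducedForm S C g l ∧ l.length = n} = {l.length} := by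
    ext n
    constructor
    · rintro ⟨m, hm, rfl⟩
      rw [hg.unique hA hm, Set.mem_singleton_iff]
    · rintro rfl
      exact ⟨l, hg, rfl⟩
  rw [reducedLength, this, csInf_singleton]

variable (S C) in
/-- The product `x * g` is reduced, with first factor `x` taken from `S i`. -/
structure IsReducedMul (i : ι) (x g : K) : Prop where
  mem : x ∈ S i
  notMem : x ∉ C
  exists_form : ∃ l, ReducedForm S C g l ∧ l.head? ≠ some i

variable (S C) in
/-- Twice the Gromov product of `g` and `h` at the identity for the word metric
`(g, h) ↦ reducedLength S C (g⁻¹ * h)`: it measures the common initial part of `g` and `h`. -/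
noncomputable def overlap (g h : K) : ℤ :=
  reducedLength S C g + reducedLength S C h - reducedLength S C (g⁻¹ * h)

theorem exists_finite_transversal {S : Subgroup K} (h : C.relIndex S ≠ 0) :
    ∃ F : Set K, F.Finite ∧ ∀ x ∈ S, ∃ r ∈ F, r⁻¹ * x ∈ C := by
  have : (C.subgroupOf S).FiniteIndex := ⟨h⟩
  refine ⟨_, Set.finite_range fun q : S ⧸ C.subgroupOf S => (q.out : K), fun x hx =>
    ⟨_, ⟨((⟨x, hx⟩ : S) : S ⧸ C.subgroupOf S), rfl⟩, ?_⟩⟩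
  exact Subgroup.mem_subgroupOf.1 (QuotientGroup.eq.1 (QuotientGroup.out_eq' _))

namespace IsAmalgam

variable (hA : IsAmalgam S C)
include hA

@[elab_as_elim]
theorem induction {p : K → Prop} (of_mem : ∀ c ∈ C, p c)
    (mul : ∀ i x g, IsReducedMul S C i x g → p g → p (x * g)) (g : K) : p g := by
  obtain ⟨l, hl⟩ := ReducedForm.exists_form hA g
  induction hl with
  | of_mem hc => exact of_mem _ hc
  | cons hx hxC hl hg ih => exact mul _ _ _ ⟨hx, hxC, _, hg, hl⟩ ih

theorem length_of_mem {c : K} (hc : c ∈ C) : reducedLength S C c = 0 :=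
  (ReducedForm.of_mem hc).length_eq hA

theorem length_mul_left {c : K} (hc : c ∈ C) (g : K) :
    reducedLength S C (c * g) = reducedLength S C g := by
  obtain ⟨l, hl⟩ := ReducedForm.exists_form hA g
  rw [hl.length_eq hA, (hl.mul_left hA hc).length_eq hA]

theorem length_inv (g : K) : reducedLength S C g⁻¹ = reducedLength S C g := by
  obtain ⟨l, hl⟩ := ReducedForm.exists_form hA g
  have := hl.inv_mul hA (.of_mem C.one_mem) (by simp)
  rw [mul_one] at this
  rw [hl.length_eq hA, this.length_eq hA, List.append_nil, List.length_reverse]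

theorem length_inv_mul_comm (g h : K) :
    reducedLength S C (g⁻¹ * h) = reducedLength S C (h⁻¹ * g) := by
  rw [← hA.length_inv, mul_inv_rev, inv_inv]

theorem length_mul {i : ι} {x g : K} (h : IsReducedMul S C i x g) :
    reducedLength S C (x * g) = reducedLength S C g + 1 := by
  obtain ⟨hx, hxC, l, hg, hl⟩ := h
  rw [(ReducedForm.cons hx hxC hl hg).length_eq hA, hg.length_eq hA, List.length_cons]

theorem mem_of_length {g : K} (hg : reducedLength S C g = 0) : g ∈ C := by
  induction g using hA.induction with
  | of_mem c hc => exact hc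
  | mul i x g h => exact absurd ((hA.length_mul h).symm.trans hg) (Nat.succ_ne_zero _)

theorem length_mem_mul_le {i : ι} {x : K} (hx : x ∈ S i) (g : K) :
    reducedLength S C (x * g) ≤ reducedLength S C g + 1 := by
  obtain ⟨l, hl⟩ := ReducedForm.exists_form hA g
  obtain ⟨m, hm, hlm⟩ := hl.exists_mul hA hx
  rwa [hl.length_eq hA, hm.length_eq hA]

theorem length_le_one {i : ι} {x : K} (hx : x ∈ S i) : reducedLength S C x ≤ 1 := by
  simpa [hA.length_of_mem C.one_mem] using hA.length_mem_mul_le hx 1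

theorem length_mul_le (g h : K) :
    reducedLength S C (g * h) ≤ reducedLength S C g + reducedLength S C h := by
  induction g using hA.induction with
  | of_mem c hc => rw [hA.length_mul_left hc]; omega
  | mul i x g hxg ih =>
    rw [mul_assoc, hA.length_mul hxg]
    have := hA.length_mem_mul_le hxg.mem (g * h)
    omega

theorem overlap_nonneg (g h : K) : 0 ≤ overlap S C g h := by
  have := hA.length_mul_le g⁻¹ h
  rw [hA.length_inv] at this
  rw [overlap]
  omega

theorem overlap_comm (g h : K) : overlap S C g h = overlap S C h g := by
  rw [overlap, overlap, hA.length_inv_mul_comm g h, add_comm (reducedLength S C g : ℤ)]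

theorem overlap_of_mem {c : K} (hc : c ∈ C) (h : K) : overlap S C c h = 0 := by
  rw [overlap, hA.length_of_mem hc, hA.length_mul_left (C.inv_mem hc)]
  omega

theorem overlap_mul_left {c : K} (hc : c ∈ C) (g h : K) :
    overlap S C (c * g) (c * h) = overlap S C g h := by
  rw [overlap, overlap, hA.length_mul_left hc, hA.length_mul_left hc]
  congr 3
  group

theorem overlap_of_ne {i j : ι} {x y g h : K} (hg : IsReducedMul S C i x g)
    (hh : IsReducedMul S C j y h) (hij : i ≠ j) : overlap S C (x * g) (y * h) = 0 := by
  obtain ⟨hx, hxC, l, hl, hli⟩ := hg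
  obtain ⟨hy, hyC, m, hm, hmj⟩ := hh
  have hxg := ReducedForm.cons hx hxC hli hl
  have hyh := ReducedForm.cons hy hyC hmj hm
  rw [overlap, hxg.length_eq hA, hyh.length_eq hA, (hxg.inv_mul_of_ne hA hij hyh).length_eq hA,
    List.length_append, List.length_reverse]
  omega

theorem overlap_of_notMem {i : ι} {x y g h : K} (hg : IsReducedMul S C i x g)
    (hh : IsReducedMul S C i y h) (hxy : x⁻¹ * y ∉ C) : overlap S C (x * g) (y * h) = 1 := by
  rw [overlap, hA.length_mul hg, hA.length_mul hh]
  obtain ⟨hx, -, l, hl, hli⟩ := hg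
  obtain ⟨hy, -, m, hm, hmi⟩ := hh
  rw [(ReducedForm.mul_inv_mul hA hx hy hxy hl hli hm hmi).length_eq hA, hl.length_eq hA,
    hm.length_eq hA, List.length_append, List.length_reverse, List.length_cons]
  omega

theorem overlap_of_inv_mul_mem {i : ι} {x y g h : K} (hg : IsReducedMul S C i x g)
    (hh : IsReducedMul S C i y h) (hxy : x⁻¹ * y ∈ C) :
    overlap S C (x * g) (y * h) = overlap S C g (x⁻¹ * y * h) + 2 := by
  rw [overlap, overlap, hA.length_mul hg, hA.length_mul hh, hA.length_mul_left hxy,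
    show (x * g)⁻¹ * (y * h) = g⁻¹ * (x⁻¹ * y * h) by group]
  push_cast
  ring

theorem overlap_le_one {i j : ι} {x y g h : K} (hg : IsReducedMul S C i x g)
    (hh : IsReducedMul S C j y h) (hne : ¬(i = j ∧ x⁻¹ * y ∈ C)) :
    overlap S C (x * g) (y * h) ≤ 1 := by
  by_cases hij : i = j
  · subst hij
    exact (hA.overlap_of_notMem hg hh fun hxy => hne ⟨rfl, hxy⟩).le
  · exact (hA.overlap_of_ne hg hh hij).trans_le zero_le_one

theorem min_overlap_le_mul {i j o : ι} {x y z g h k : K} (hg : IsReducedMul S C i x g)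
    (hh : IsReducedMul S C j y h) (hk : IsReducedMul S C o z k)
    (ih : ∀ h k, min (overlap S C g k) (overlap S C h k) ≤ overlap S C g h) :
    min (overlap S C (x * g) (z * k)) (overlap S C (y * h) (z * k))
      ≤ overlap S C (x * g) (y * h) := by
  rcases ne_or_eq i j with hij | rfl
  · rcases ne_or_eq i o with hio | rfl
    · exact min_le_of_left_le ((hA.overlap_of_ne hg hk hio).trans_le (hA.overlap_nonneg _ _))
    · exact min_le_of_right_le ((hA.overlap_of_ne hh hk hij.symm).trans_le (hA.overlap_nonneg _ _))
  by_cases hxz : i = o ∧ x⁻¹ * z ∈ C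
  · obtain ⟨rfl, hxz⟩ := hxz
    by_cases hxy : x⁻¹ * y ∈ C
    · have hyz : y⁻¹ * z ∈ C := by simpa [mul_assoc] using C.mul_mem (C.inv_mem hxy) hxz
      have hcancel := hA.overlap_mul_left hxy h (y⁻¹ * z * k)
      rw [show x⁻¹ * y * (y⁻¹ * z * k) = x⁻¹ * z * k by group] at hcancel
      rw [hA.overlap_of_inv_mul_mem hg hk hxz, hA.overlap_of_inv_mul_mem hg hh hxy,
        hA.overlap_of_inv_mul_mem hh hk hyz, ← hcancel, min_add_add_right]
      exact Int.add_le_add_right (ih _ _) 2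
    · refine min_le_of_right_le ((hA.overlap_of_notMem hg hh hxy).symm ▸ ?_)
      refine hA.overlap_le_one hh hk fun ⟨_, hyz⟩ => hxy ?_
      simpa [mul_assoc] using C.mul_mem hxz (C.inv_mem hyz)
  · refine min_le_of_left_le ((hA.overlap_le_one hg hk hxz).trans ?_)
    by_cases hxy : x⁻¹ * y ∈ C
    · linarith [hA.overlap_of_inv_mul_mem hg hh hxy, hA.overlap_nonneg g (x⁻¹ * y * h)]
    · exact (hA.overlap_of_notMem hg hh hxy).ge

theorem min_overlap_le (g h k : K) :
    min (overlap S C g k) (overlap S C h k) ≤ overlap S C g h := by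
  induction g using hA.induction generalizing h k with
  | of_mem c hc => simp only [hA.overlap_of_mem hc, min_le_left]
  | mul i x g hxg ih =>
    induction h using hA.induction with
    | of_mem c hc =>
      rw [hA.overlap_of_mem hc, hA.overlap_comm _ c, hA.overlap_of_mem hc]
      exact min_le_right _ _
    | mul j y h hyh =>
      induction k using hA.induction with
      | of_mem c hc =>
        rw [hA.overlap_comm _ c, hA.overlap_of_mem hc]
        exact min_le_of_left_le (hA.overlap_nonneg _ _)
      | mul o z k hzk => exact hA.min_overlap_le_mul hxg hyh hzk ih

theorem isTreeMetric :
    IsTreeMetric fun g h : K => (reducedLength S C (g⁻¹ * h) : ℝ) where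
  self x := by rw [inv_mul_cancel, hA.length_of_mem C.one_mem, Nat.cast_zero]
  symm x y := by rw [hA.length_inv_mul_comm]
  four_point x y z w := by
    have hbase (u v : K) : (w⁻¹ * u)⁻¹ * (w⁻¹ * v) = u⁻¹ * v := by group
    have h := hA.min_overlap_le (w⁻¹ * x) (w⁻¹ * y) (w⁻¹ * z)
    simp only [overlap, hbase, hA.length_inv_mul_comm w] at h
    norm_cast
    omega

theorem exists_factor [Nonempty ι] (k : K) {s : ℝ}
    (hs : s ∈ Set.Icc 0 (reducedLength S C k : ℝ)) :
    ∃ i, ∃ g x h : K, x ∈ S i ∧ k = g * x * h ∧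
      reducedLength S C k = reducedLength S C g + reducedLength S C x + reducedLength S C h ∧
      s ∈ Set.Icc (reducedLength S C g : ℝ) (reducedLength S C g + reducedLength S C x) := by
  have hone : reducedLength S C 1 = 0 := hA.length_of_mem C.one_mem
  induction k using hA.induction generalizing s with
  | of_mem c hc =>
    obtain ⟨i⟩ := ‹Nonempty ι›
    rw [hA.length_of_mem hc, Nat.cast_zero, Set.Icc_self, Set.mem_singleton_iff] at hs
    exact ⟨i, 1, 1, c, (S i).one_mem, by group, by omega, by simp [hone, hs]⟩
  | mul i x g hxg ih =>
    have hlength := hA.length_mul hxg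
    rcases le_total s 1 with hs1 | hs1
    · have hx : reducedLength S C x = 1 := by
        have := hA.length_mul_le x g
        have := hA.length_le_one hxg.mem
        omega
      exact ⟨i, 1, x, g, hxg.mem, by group, by omega, by simpa [hone, hx] using ⟨hs.1, hs1⟩⟩
    · rw [hlength, Nat.cast_succ] at hs
      obtain ⟨j, g₁, y, g₂, hy, rfl, hsum, hmem⟩ :=
        ih (s := s - 1) ⟨sub_nonneg.2 hs1, sub_le_iff_le_add.2 hs.2⟩
      have hassoc : x * (g₁ * y * g₂) = x * g₁ * y * g₂ := by group
      have hxg₁ : reducedLength S C (x * g₁) = reducedLength S C g₁ + 1 := by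
        have := hA.length_mem_mul_le hxg.mem g₁
        have := hA.length_mul_le (x * g₁ * y) g₂
        have := hA.length_mul_le (x * g₁) y
        rw [hassoc] at hlength
        omega
      refine ⟨j, x * g₁, y, g₂, hy, hassoc, by omega, ?_⟩
      rw [hxg₁, Nat.cast_succ]
      exact ⟨by linarith [hmem.1], by linarith [hmem.2]⟩

theorem exists_finite_transversal_length_le [Finite ι] (hfin : ∀ i, C.relIndex (S i) ≠ 0)
    (n : ℕ) : ∃ F : Set K, F.Finite ∧ ∀ g, reducedLength S C g ≤ n → ∃ r ∈ F, r⁻¹ * g ∈ C := by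
  choose F hF hFS using fun i => exists_finite_transversal (hfin i)
  induction n with
  | zero =>
    refine ⟨{1}, Set.finite_singleton 1, fun g hg => ⟨1, rfl, ?_⟩⟩
    rw [inv_one, one_mul]
    exact hA.mem_of_length (Nat.le_zero.1 hg)
  | succ n ih =>
    obtain ⟨E, hE, hES⟩ := ih
    refine ⟨E ∪ ⋃ i, Set.image2 (· * ·) (F i) E,
      hE.union (Set.finite_iUnion fun i => (hF i).image2 _ hE), fun g hg => ?_⟩
    induction g using hA.induction with
    | of_mem c hc =>
      obtain ⟨r, hr, hrc⟩ := hES c ((hA.length_of_mem hc).trans_le n.zero_le)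
      exact ⟨r, Or.inl hr, hrc⟩
    | mul i x g hxg =>
      obtain ⟨r, hr, hrx⟩ := hFS i x hxg.mem
      rw [hA.length_mul hxg] at hg
      obtain ⟨r', hr', hrg⟩ := hES (r⁻¹ * x * g)
        ((hA.length_mul_left hrx g).trans_le (Nat.le_of_succ_le_succ hg))
      refine ⟨r * r', Or.inr (Set.mem_iUnion.2 ⟨i, r, hr, r', hr', rfl⟩), ?_⟩
      rwa [mul_inv_rev, mul_assoc, ← mul_assoc r⁻¹]

end IsAmalgam

end ReducedForm

/-! ### Geometric actions on products -/

section Product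

variable {Γ X Y : Type*} [Group Γ] [MulAction Γ X] [MulAction Γ Y]

theorem isIsometricSMul_withLp_prod [PseudoMetricSpace X] [PseudoMetricSpace Y]
    [IsIsometricSMul Γ X] [IsIsometricSMul Γ Y] : IsIsometricSMul Γ (WithLp 2 (X × Y)) where
  isometry_smul g := Isometry.of_dist_eq fun u v => by
    refine (sq_eq_sq₀ dist_nonneg dist_nonneg).1 ?_
    rw [withLp_prod_dist_sq, withLp_prod_dist_sq]
    change dist (g • u.fst) (g • v.fst) ^ 2 + dist (g • u.snd) (g • v.snd) ^ 2 = _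
    rw [dist_smul, dist_smul]

theorem finite_dist_smul_le [PseudoMetricSpace X] [PseudoMetricSpace Y] [IsIsometricSMul Γ Y]
    {C : Subgroup Γ} {x : X} {r : ℝ}
    (hX : ∃ F : Set Γ, F.Finite ∧ ∃ k, ∀ g : Γ, dist (g • x) x ≤ r → ∃ u ∈ F, u⁻¹ * g * k ∈ C)
    (hY : ∀ p q : Y, {c | c ∈ C ∧ dist (c • p) q ≤ r}.Finite) (y : Y) :
    {g : Γ | dist (g • x) x ≤ r ∧ dist (g • y) y ≤ r}.Finite := by
  obtain ⟨F, hF, k, hFk⟩ := hX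
  refine (hF.biUnion fun u _ =>
    (hY (k⁻¹ • y) (u⁻¹ • y)).image fun c => u * c * k⁻¹).subset ?_
  rintro g ⟨hgx, hgy⟩
  obtain ⟨u, hu, hgu⟩ := hFk g hgx
  refine Set.mem_biUnion hu ⟨u⁻¹ * g * k, ⟨hgu, ?_⟩, by group⟩
  rwa [mul_smul, smul_inv_smul, mul_smul, dist_smul]

end Product

theorem isGeometricAction_withLp_prod {Γ X Y : Type} [Group Γ] [MetricSpace X] [MetricSpace Y]
    [MulAction Γ X] [IsIsometricSMul Γ X] [MulAction Γ Y] [IsIsometricSMul Γ Y] {C : Subgroup Γ}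
    (hXproper : ∀ (x : X) (r : ℝ), ∃ F : Set Γ, F.Finite ∧ ∃ k, ∀ g : Γ,
      dist (g • x) x ≤ r → ∃ u ∈ F, u⁻¹ * g * k ∈ C)
    (hXcocompact : ∃ Q : Set X, IsCompact Q ∧ ∀ x, ∃ g : Γ, ∀ c ∈ C, c • g • x ∈ Q)
    (hYproper : ∀ (p q : Y) (r : ℝ), {c | c ∈ C ∧ dist (c • p) q ≤ r}.Finite)
    (hYcocompact : ∃ D : Set Y, IsCompact D ∧ ∀ p, ∃ c ∈ C, c • p ∈ D) :
    IsGeometricAction Γ (WithLp 2 (X × Y)) := by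
  have := isIsometricSMul_withLp_prod (Γ := Γ) (X := X) (Y := Y)
  refine ⟨dist_smul, fun z => ⟨1, one_pos, ?_⟩, ?_⟩
  · refine (finite_dist_smul_le (hXproper z.fst 2) (hYproper · · 2) z.snd).subset ?_
    rintro g ⟨w, hw, hgw⟩
    have hgz : dist (g • z) z ^ 2 ≤ 2 ^ 2 := by
      have := dist_triangle_left (g • z) z (g • w)
      rw [dist_smul] at this
      exact pow_le_pow_left₀ dist_nonneg (by rw [Metric.mem_ball] at hw hgw; linarith) 2
    rw [withLp_prod_dist_sq] at hgz
    exact ⟨le_of_sq_le_sq ((le_add_of_nonneg_right (sq_nonneg _)).trans hgz) zero_le_two,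
      le_of_sq_le_sq ((le_add_of_nonneg_left (sq_nonneg _)).trans hgz) zero_le_two⟩
  · obtain ⟨Q, hQ, hQΓ⟩ := hXcocompact
    obtain ⟨D, hD, hDC⟩ := hYcocompact
    refine ⟨WithLp.toLp 2 '' (Q ×ˢ D), (hQ.prod hD).image (WithLp.prod_continuous_toLp 2 X Y),
      fun z => ?_⟩
    obtain ⟨g, hg⟩ := hQΓ z.fst
    obtain ⟨c, hc, hcD⟩ := hDC (g • z.snd)
    exact ⟨(c * g)⁻¹, c • g • z, ⟨(c • g • z.fst, c • g • z.snd), ⟨hg c hc, hcD⟩, rfl⟩,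
      by rw [← mul_smul c, inv_smul_smul]⟩

/-! ### The action of an amalgam on its tree -/

namespace IsAmalgam

variable {ι K : Type} [Group K] {S : ι → Subgroup K} {C : Subgroup K} (hA : IsAmalgam S C)

/-- The Bass–Serre tree of an amalgamated product, before points at distance zero are identified.
It is spanned by the word metric of reduced forms, in which elements congruent modulo `C` have
distance zero.  The edges of the usual Bass–Serre tree are the cosets of `C`, and so its edge
midpoints play the role of vertices here. -/
abbrev Tree : Type := TreePoint hA.isTreeMetric

instance : MulAction K hA.Tree where
  smul g x := ⟨g * x.fst, g * x.snd, x.a, x.b, x.a_nonneg, x.b_nonneg, by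
    rw [x.add_eq, mul_inv_rev, mul_assoc, inv_mul_cancel_left]⟩
  one_smul x := by
    change TreePoint.mk _ _ _ _ _ _ _ = x
    simp only [one_mul]
  mul_smul g h x := by
    change TreePoint.mk _ _ _ _ _ _ _ = TreePoint.mk _ _ _ _ _ _ _
    simp only [mul_assoc]
    rfl

theorem smul_fst (g : K) (x : hA.Tree) : (g • x).fst = g * x.fst := rfl

theorem smul_snd (g : K) (x : hA.Tree) : (g • x).snd = g * x.snd := rfl

instance : IsIsometricSMul K hA.Tree where
  isometry_smul g := Isometry.of_dist_eq fun x y => by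
    have hcancel (u v : K) : (g * u)⁻¹ * (g * v) = u⁻¹ * v := by group
    simp only [TreePoint.dist_eq, smul_fst, smul_snd, hcancel]
    rfl

instance : IsIsometricSMul K (SeparationQuotient hA.Tree) where
  isometry_smul g := Isometry.of_dist_eq <| SeparationQuotient.surjective_mk.forall₂.2 fun x y => by
    rw [← SeparationQuotient.mk_smul, ← SeparationQuotient.mk_smul, SeparationQuotient.dist_mk,
      SeparationQuotient.dist_mk, dist_smul]

theorem exists_finite_of_dist_smul_le [Finite ι] (hfin : ∀ i, C.relIndex (S i) ≠ 0)
    (x : SeparationQuotient hA.Tree) (r : ℝ) : ∃ F : Set K, F.Finite ∧ ∃ k, ∀ g : K,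
      dist (g • x) x ≤ r → ∃ u ∈ F, u⁻¹ * g * k ∈ C := by
  obtain ⟨x, rfl⟩ := SeparationQuotient.surjective_mk x
  obtain ⟨n, hn⟩ := exists_nat_ge (r + 2 * x.a)
  obtain ⟨F, hF, hFC⟩ := hA.exists_finite_transversal_length_le hfin n
  refine ⟨(x.fst * ·) '' F, hF.image _, x.fst, fun g hg => ?_⟩
  have hlength : reducedLength S C (x.fst⁻¹ * (g * x.fst)) ≤ n := by
    rw [← SeparationQuotient.mk_smul, SeparationQuotient.dist_mk, dist_comm,
      TreePoint.dist_eq] at hg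
    have hfst : (reducedLength S C (x.fst⁻¹ * (g * x.fst)) : ℝ) - x.a - x.a ≤ r :=
      (le_max_left _ _).trans ((le_max_left _ _).trans hg)
    exact_mod_cast (by linarith : (reducedLength S C (x.fst⁻¹ * (g * x.fst)) : ℝ) ≤ n)
  obtain ⟨u, hu, hgu⟩ := hFC _ hlength
  exact ⟨_, ⟨u, hu, rfl⟩, by simpa only [mul_inv_rev, mul_assoc] using hgu⟩

/-- The point of the tree that is given by the coset of `g` modulo `C`. -/
noncomputable def vertex (g : K) : SeparationQuotient hA.Tree :=
  SeparationQuotient.mk (TreePoint.ofVertex g)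

theorem dist_mk_vertex (x : hA.Tree) (g : K) :
    dist (SeparationQuotient.mk x) (hA.vertex g) = x.toVertex g := by
  rw [vertex, SeparationQuotient.dist_mk, TreePoint.dist_ofVertex]

theorem dist_vertex (g h : K) :
    dist (hA.vertex g) (hA.vertex h) = reducedLength S C (g⁻¹ * h) := by
  rw [vertex, dist_mk_vertex, TreePoint.toVertex]
  exact (max_self _).trans (sub_zero _)

theorem vertex_eq_vertex {g h : K} (hgh : g⁻¹ * h ∈ C) : hA.vertex g = hA.vertex h := by
  rw [← dist_eq_zero, dist_vertex, hA.length_of_mem hgh, Nat.cast_zero]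

theorem smul_vertex (g h : K) : g • hA.vertex h = hA.vertex (g * h) := rfl

/-- The segment from the vertex `1` to the vertex `y` in the tree. -/
def segment (y : K) : Set (SeparationQuotient hA.Tree) :=
  {x | dist (hA.vertex 1) x + dist x (hA.vertex y) ≤ reducedLength S C y}

/-- The point of the segment from `1` to `y` at distance `s` from `1`. -/
noncomputable def segmentPoint (y : K) (s : Set.Icc 0 (reducedLength S C y : ℝ)) : hA.Tree :=
  ⟨1, y, s, reducedLength S C y - s, s.2.1, sub_nonneg.2 s.2.2, by
    rw [inv_one, one_mul, add_sub_cancel]⟩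

theorem continuous_segmentPoint (y : K) : Continuous (hA.segmentPoint y) := by
  refine (LipschitzWith.of_dist_le_mul (K := 1) fun s t => ?_).continuous
  rw [NNReal.coe_one, one_mul, TreePoint.dist_eq, Subtype.dist_eq, Real.dist_eq]
  have hone := hA.length_of_mem C.one_mem
  simp only [segmentPoint, inv_one, one_mul, mul_one, inv_mul_cancel, hA.length_inv, hone,
    Nat.cast_zero]
  have hst := le_abs_self (s - t : ℝ)
  have hts := neg_abs_le (s - t : ℝ)
  refine max_le (max_le ?_ ?_) (max_le ?_ ?_) <;>
    linarith [s.2.1, s.2.2, t.2.1, t.2.2, abs_nonneg (s - t : ℝ)]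

theorem isCompact_segment (y : K) : IsCompact (hA.segment y) := by
  refine (isCompact_range (SeparationQuotient.continuous_mk.comp
    (hA.continuous_segmentPoint y))).of_isClosed_subset (isClosed_le (by fun_prop) (by fun_prop))
    (SeparationQuotient.surjective_mk.forall.2 fun x hx => ?_)
  rw [segment, Set.mem_ofPred_eq, dist_comm, dist_mk_vertex, dist_mk_vertex] at hx
  have hone := x.toVertex_nonneg 1
  refine ⟨⟨x.toVertex 1, hone, by linarith [x.toVertex_nonneg y]⟩, ?_⟩
  rw [← dist_eq_zero, Function.comp_apply, SeparationQuotient.dist_mk]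
  exact TreePoint.dist_eq_zero_of_toVertex_le le_rfl (le_sub_iff_add_le'.2 hx)

theorem smul_mem_segment {c r y : K} (hc : c ∈ C) (hr : r⁻¹ * (c * y) ∈ C)
    {x : SeparationQuotient hA.Tree} (hx : x ∈ hA.segment y) : c • x ∈ hA.segment r := by
  have hone : hA.vertex 1 = c • hA.vertex 1 := by
    rw [smul_vertex, mul_one]
    exact hA.vertex_eq_vertex (by rwa [inv_one, one_mul])
  have hlength (z : K) : (reducedLength S C z : ℝ) = dist (hA.vertex 1) (hA.vertex z) := by
    rw [dist_vertex, inv_one, one_mul]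
  rw [segment, Set.mem_ofPred_eq, hlength] at hx ⊢
  rwa [hA.vertex_eq_vertex hr, ← smul_vertex, hone, dist_smul, dist_smul, dist_smul]

theorem exists_smul_mem_segment [Nonempty ι] (x : SeparationQuotient hA.Tree) :
    ∃ i, ∃ g : K, ∃ y ∈ S i, g • x ∈ hA.segment y := by
  obtain ⟨x, rfl⟩ := SeparationQuotient.surjective_mk x
  have hab := x.add_eq
  obtain ⟨i, g, y, h, hy, hghy, hlength, hga, hay⟩ :=
    hA.exists_factor (x.fst⁻¹ * x.snd) (s := x.a) ⟨x.a_nonneg, by linarith [x.b_nonneg]⟩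
  rw [hlength] at hab
  push_cast at hab
  have htoVertex (z : K) : x.toVertex (x.fst * z) =
      max (reducedLength S C z - x.a) (reducedLength S C (z⁻¹ * (g * y * h)) - x.b) := by
    rw [TreePoint.toVertex, inv_mul_cancel_left, hA.length_inv_mul_comm x.snd, ← hghy, mul_inv_rev,
      mul_assoc]
  have hnear : x.toVertex (x.fst * g) ≤ x.a - reducedLength S C g := by
    have hyh : (reducedLength S C (y * h) : ℝ) ≤ reducedLength S C y + reducedLength S C h :=
      mod_cast hA.length_mul_le y h
    rw [htoVertex, mul_assoc, inv_mul_cancel_left]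
    exact max_le (by linarith) (by linarith)
  have hfar : x.toVertex (x.fst * (g * y)) ≤
      reducedLength S C g + reducedLength S C y - x.a := by
    have hgy : (reducedLength S C (g * y) : ℝ) ≤ reducedLength S C g + reducedLength S C y :=
      mod_cast hA.length_mul_le g y
    rw [htoVertex, inv_mul_cancel_left]
    exact max_le (by linarith) (by linarith)
  refine ⟨i, (x.fst * g)⁻¹, y, hy, ?_⟩
  rw [segment, Set.mem_ofPred_eq, ← dist_smul (x.fst * g), ← dist_smul (x.fst * g) _ (hA.vertex y),
    smul_inv_smul, smul_vertex, smul_vertex, dist_comm, dist_mk_vertex, dist_mk_vertex, mul_one,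
    mul_assoc]
  linarith

theorem exists_isCompact_smul_mem [Finite ι] [Nonempty ι] (hfin : ∀ i, C.relIndex (S i) ≠ 0) :
    ∃ Q : Set (SeparationQuotient hA.Tree), IsCompact Q ∧
      ∀ x, ∃ g : K, ∀ c ∈ C, c • g • x ∈ Q := by
  choose F hF hFS using fun i => exists_finite_transversal (hfin i)
  refine ⟨⋃ i, ⋃ r ∈ F i, hA.segment r, isCompact_iUnion fun i =>
    (hF i).isCompact_biUnion fun r _ => hA.isCompact_segment r, fun x => ?_⟩
  obtain ⟨i, g, y, hy, hgx⟩ := hA.exists_smul_mem_segment x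
  refine ⟨g, fun c hc => ?_⟩
  obtain ⟨r, hr, hrC⟩ := hFS i (c * y) ((S i).mul_mem (hA.le i hc) hy)
  exact Set.mem_iUnion.2 ⟨i, Set.mem_biUnion hr (hA.smul_mem_segment hc hrC hgx)⟩

theorem isCAT0Group [Finite ι] [Nonempty ι] (hA : IsAmalgam S C)
    (hfin : ∀ i, C.relIndex (S i) ≠ 0) {E : Type} [NormedAddCommGroup E]
    [InnerProductSpace ℝ E] [MulAction K E] [IsIsometricSMul K E]
    (hproper : ∀ (p q : E) (r : ℝ), {c | c ∈ C ∧ dist (c • p) q ≤ r}.Finite)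
    (hcocompact : ∃ D : Set E, IsCompact D ∧ ∀ p, ∃ c ∈ C, c • p ∈ D) : IsCAT0Group K :=
  ⟨WithLp 2 (SeparationQuotient hA.Tree × E), inferInstance, inferInstance,
    ⟨WithLp.toLp 2 (SeparationQuotient.mk (TreePoint.ofVertex 1), 0)⟩,
    (TreePoint.hasCN.separationQuotient.prod hasCN_of_innerProductSpace).isCAT0Space,
    isGeometricAction_withLp_prod (hA.exists_finite_of_dist_smul_le hfin)
      (hA.exists_isCompact_smul_mem hfin) hproper hcocompact⟩

end IsAmalgam

/-! ### Extensions of index two -/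

section IndexTwo

/-- The data that determine a group containing `N` as a subgroup of index two: conjugation of `N`
by an element `h` outside `N`, and the square of `h`. -/
structure IndexTwoDatum (N : Type*) [Group N] where
  conj : N →* N
  sq : N
  conj_sq : conj sq = sq
  conj_conj : ∀ n, conj (conj n) = sq * n * sq⁻¹

/-- `ι` embeds `N` as a subgroup of index two of `H`, and `h` is an element outside `N` whose
conjugation action on `N` and whose square are given by `D`. -/
structure IsIndexTwoExtension {N H : Type*} [Group N] [Group H] (D : IndexTwoDatum N)
    (ι : N →* H) (h : H) : Prop where
  injective : Function.Injective ι
  index_eq : ι.range.index = 2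
  notMem : h ∉ ι.range
  mul_self : h * h = ι D.sq
  conj : ∀ n, h * ι n * h⁻¹ = ι (D.conj n)

variable {N H P : Type*} [Group N] [Group H] [Group P]

theorem exists_isIndexTwoExtension {ι : N →* H} (hι : Function.Injective ι)
    (hindex : ι.range.index = 2) {h : H} (hh : h ∉ ι.range) {σ : N →* N}
    (hσ : ∀ n, h * ι n * h⁻¹ = ι (σ n)) :
    ∃ D : IndexTwoDatum N, D.conj = σ ∧ IsIndexTwoExtension D ι h := by
  obtain ⟨a, ha⟩ : h * h ∈ ι.range := Subgroup.mul_self_mem_of_index_two hindex h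
  refine ⟨⟨σ, a, hι ?_, fun n => hι ?_⟩, rfl, hι, hindex, hh, ha.symm, hσ⟩
  · rw [← hσ, ha]
    group
  · rw [← hσ, ← hσ, map_mul, map_mul, map_inv, ha]
    group

namespace IndexTwoDatum

theorem conj_conj_of_comm {N : Type*} [CommGroup N] (D : IndexTwoDatum N) (n : N) :
    D.conj (D.conj n) = n := by
  rw [D.conj_conj, mul_inv_cancel_comm]

variable {D : IndexTwoDatum N}

/-- The extension determined by `D`: the pair `(n, s)` stands for `n` if `s` is `false`, and for
`n * h`, where `h` is the adjoined element, if `s` is `true`. -/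
@[ext]
structure Extension (D : IndexTwoDatum N) where
  left : N
  right : Bool

namespace Extension

instance : One D.Extension := ⟨⟨1, false⟩⟩

instance : Mul D.Extension where
  mul
    | ⟨x, false⟩, ⟨y, t⟩ => ⟨x * y, t⟩
    | ⟨x, true⟩, ⟨y, false⟩ => ⟨x * D.conj y, true⟩
    | ⟨x, true⟩, ⟨y, true⟩ => ⟨x * D.conj y * D.sq, false⟩

instance : Inv D.Extension where
  inv
    | ⟨x, false⟩ => ⟨x⁻¹, false⟩
    | ⟨x, true⟩ => ⟨D.sq⁻¹ * (D.conj x)⁻¹, true⟩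

theorem one_def : (1 : D.Extension) = ⟨1, false⟩ := rfl

theorem mk_false_mul (x y : N) (t : Bool) : (⟨x, false⟩ * ⟨y, t⟩ : D.Extension) = ⟨x * y, t⟩ := rfl

theorem mk_true_mul_mk_false (x y : N) :
    (⟨x, true⟩ * ⟨y, false⟩ : D.Extension) = ⟨x * D.conj y, true⟩ :=
  rfl

theorem mk_true_mul_mk_true (x y : N) :
    (⟨x, true⟩ * ⟨y, true⟩ : D.Extension) = ⟨x * D.conj y * D.sq, false⟩ :=
  rfl

theorem inv_mk_false (x : N) : (⟨x, false⟩ : D.Extension)⁻¹ = ⟨x⁻¹, false⟩ := rfl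

theorem inv_mk_true (x : N) : (⟨x, true⟩ : D.Extension)⁻¹ = ⟨D.sq⁻¹ * (D.conj x)⁻¹, true⟩ := rfl

instance : Group D.Extension := Group.ofLeftAxioms
  (by
    rintro ⟨x, _ | _⟩ ⟨y, _ | _⟩ ⟨z, _ | _⟩ <;>
      simp only [mk_false_mul, mk_true_mul_mk_false, mk_true_mul_mk_true, map_mul, D.conj_conj,
        D.conj_sq, mul_assoc, inv_mul_cancel, mul_one])
  (by
    rintro ⟨x, t⟩
    rw [one_def, mk_false_mul, one_mul])
  (by
    rintro ⟨x, _ | _⟩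
    · rw [inv_mk_false, mk_false_mul, inv_mul_cancel, one_def]
    · rw [inv_mk_true, mk_true_mul_mk_true, inv_mul_cancel_right, inv_mul_cancel, one_def])

variable (D) in
/-- The inclusion of `N` into the extension. -/
def of : N →* D.Extension where
  toFun x := ⟨x, false⟩
  map_one' := rfl
  map_mul' _ _ := rfl

variable (D) in
/-- The element adjoined to `N`. -/
def root : D.Extension := ⟨1, true⟩

theorem mk_false_eq (x : N) : (⟨x, false⟩ : D.Extension) = of D x := rfl

theorem mk_true_eq (x : N) : (⟨x, true⟩ : D.Extension) = of D x * root D := by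
  rw [of, root, MonoidHom.coe_mk, OneHom.coe_mk, mk_false_mul, mul_one]

theorem mem_range_of {x : D.Extension} : x ∈ (of D).range ↔ x.right = false :=
  ⟨fun ⟨_, hn⟩ => hn ▸ rfl, fun hx => ⟨x.left, Extension.ext rfl hx.symm⟩⟩

theorem isIndexTwoExtension : IsIndexTwoExtension D (of D) (root D) where
  injective _ _ hxy := congrArg left hxy
  index_eq := Subgroup.index_eq_two_iff.2 ⟨root D, fun x => by
    rcases x with ⟨x, _ | _⟩ <;>
      simp only [root, mem_range_of, mk_false_mul, mk_true_mul_mk_true,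
        xor_true, xor_false, Bool.true_eq_false, not_false_iff, id]⟩
  notMem h := Bool.noConfusion (mem_range_of.1 h)
  mul_self := by rw [root, mk_true_mul_mk_true, map_one, one_mul, one_mul, mk_false_eq]
  conj n := by
    rw [mul_inv_eq_iff_eq_mul, ← mk_true_eq, ← mk_false_eq, root, mk_true_mul_mk_false, one_mul]

/-- The homomorphism out of the extension that is given by `φ` on `N` and sends the adjoined
element to `m`. -/
def lift (φ : N →* P) (m : P) (hsq : m * m = φ D.sq)
    (hconj : ∀ n, m * φ n * m⁻¹ = φ (D.conj n)) : D.Extension →* P :=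
  MonoidHom.mk' (fun x => φ x.left * bif x.right then m else 1) <| by
    rintro ⟨x, _ | _⟩ ⟨y, _ | _⟩ <;>
      simp only [mk_false_mul, mk_true_mul_mk_false, mk_true_mul_mk_true, map_mul, ← hconj, ← hsq,
        cond_true, cond_false, mul_one, mul_assoc, inv_mul_cancel, inv_mul_cancel_left]

variable {φ : N →* P} {m : P} (hsq : m * m = φ D.sq)
  (hconj : ∀ n, m * φ n * m⁻¹ = φ (D.conj n))

theorem lift_of (n : N) : lift φ m hsq hconj (of D n) = φ n := mul_one _

theorem lift_root : lift φ m hsq hconj (root D) = m :=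
  (congrArg (· * m) (map_one φ)).trans (one_mul m)

end Extension

end IndexTwoDatum

namespace IsIndexTwoExtension

open IndexTwoDatum

variable {D : IndexTwoDatum N} {ι : N →* H} {h : H}

theorem eq_or_eq_mul (E : IsIndexTwoExtension D ι h) (x : H) :
    (∃ n, x = ι n) ∨ ∃ n, x = ι n * h := by
  by_cases hx : x ∈ ι.range
  · obtain ⟨n, rfl⟩ := hx
    exact Or.inl ⟨n, rfl⟩
  · obtain ⟨n, hn⟩ : x * h⁻¹ ∈ ι.range := by
      rw [Subgroup.mul_mem_iff_of_index_two E.index_eq, inv_mem_iff]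
      exact iff_of_false hx E.notMem
    exact Or.inr ⟨n, by rw [hn, inv_mul_cancel_right]⟩

theorem mul_apply (E : IsIndexTwoExtension D ι h) (n : N) : h * ι n = ι (D.conj n) * h :=
  mul_inv_eq_iff_eq_mul.1 (E.conj n)

theorem hom_ext (E : IsIndexTwoExtension D ι h) {f g : H →* P} (hι : ∀ n, f (ι n) = g (ι n))
    (hh : f h = g h) : f = g := by
  ext x
  rcases E.eq_or_eq_mul x with ⟨n, rfl⟩ | ⟨n, rfl⟩
  · exact hι n
  · rw [map_mul, map_mul, hι, hh]

theorem conj_of_notMem {N : Type*} [CommGroup N] {D : IndexTwoDatum N} {ι : N →* H}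
    (E : IsIndexTwoExtension D ι h) {x : H} (hx : x ∉ ι.range) (n : N) :
    x * ι n * x⁻¹ = ι (D.conj n) := by
  rcases E.eq_or_eq_mul x with ⟨m, rfl⟩ | ⟨m, rfl⟩
  · exact absurd ⟨m, rfl⟩ hx
  · calc ι m * h * ι n * (ι m * h)⁻¹ = ι m * (h * ι n * h⁻¹) * (ι m)⁻¹ := by group
      _ = ι (D.conj n) := by rw [E.conj, ← map_inv, ← map_mul, ← map_mul, mul_inv_cancel_comm]

theorem bijective_lift (E : IsIndexTwoExtension D ι h) :
    Function.Bijective (Extension.lift ι h E.mul_self E.conj) := by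
  refine ⟨(injective_iff_map_eq_one _).2 ?_, fun x => ?_⟩
  · rintro ⟨x, _ | _⟩ hx
    · rw [Extension.mk_false_eq] at hx ⊢
      rw [Extension.lift_of] at hx
      rw [E.injective (hx.trans (map_one ι).symm), map_one]
    · exact absurd ⟨x⁻¹, (map_inv ι x).trans (inv_eq_of_mul_eq_one_right hx)⟩ E.notMem
  · rcases E.eq_or_eq_mul x with ⟨n, rfl⟩ | ⟨n, rfl⟩
    · exact ⟨⟨n, false⟩, mul_one _⟩
    · exact ⟨⟨n, true⟩, rfl⟩

theorem exists_lift (E : IsIndexTwoExtension D ι h) (φ : N →* P) (m : P)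
    (hsq : m * m = φ D.sq) (hconj : ∀ n, m * φ n * m⁻¹ = φ (D.conj n)) :
    ∃ Φ : H →* P, (∀ n, Φ (ι n) = φ n) ∧ Φ h = m := by
  let e := MulEquiv.ofBijective _ E.bijective_lift
  refine ⟨(Extension.lift φ m hsq hconj).comp e.symm.toMonoidHom, fun n => ?_, ?_⟩
  · have he : e.symm (ι n) = Extension.of D n :=
      e.symm_apply_eq.2 (Extension.lift_of E.mul_self E.conj n).symm
    exact (congrArg _ he).trans (Extension.lift_of hsq hconj n)
  · have he : e.symm h = Extension.root D :=
      e.symm_apply_eq.2 (Extension.lift_root E.mul_self E.conj).symm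
    exact (congrArg _ he).trans (Extension.lift_root hsq hconj)

theorem of_mulEquiv (E : IsIndexTwoExtension D ι h) (e : H ≃* P) :
    IsIndexTwoExtension D (e.toMonoidHom.comp ι) (e h) where
  injective := e.injective.comp E.injective
  index_eq := by
    rw [MonoidHom.range_comp]
    exact (Subgroup.index_map_equiv _ e).trans E.index_eq
  notMem := by
    rintro ⟨n, hn⟩
    exact E.notMem ⟨n, e.injective hn⟩
  mul_self := by rw [← map_mul, E.mul_self]; rfl
  conj n := (by rw [← E.conj, map_mul, map_mul, map_inv]; rfl : _ = e (ι (D.conj n)))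

end IsIndexTwoExtension

end IndexTwo

section IndexTwoOvergroup

variable {n : ℕ} {V : Type} [AddCommGroup V] {j : V →+ (Fin n → ℚ)} {B : Matrix (Fin n) (Fin n) ℚ}
  {σ : V →+ V}

theorem exists_isIndexTwoOvergroup (hσσ : ∀ v, σ (σ v) = v)
    (hσ : ∀ v, j (σ v) = B.mulVec (j v)) :
    ∃ (H : Type) (_ : Group H) (ι : Multiplicative V →* H), IsIndexTwoOvergroup j B ι := by
  let D : IndexTwoDatum (Multiplicative V) :=
    { conj := AddMonoidHom.toMultiplicative σ
      sq := 1
      conj_sq := map_one _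
      conj_conj := fun v => (congrArg Multiplicative.ofAdd (hσσ v.toAdd)).trans (by simp) }
  have E := IndexTwoDatum.Extension.isIndexTwoExtension (D := D)
  exact ⟨D.Extension, inferInstance, IndexTwoDatum.Extension.of D, E.injective, E.index_eq,
    fun h hh v => ⟨σ v, hσ v, E.conj_of_notMem hh _⟩⟩

theorem IsIndexTwoOvergroup.exists_isIndexTwoExtension {H : Type} [Group H]
    {ι : Multiplicative V →* H} (hι : IsIndexTwoOvergroup j B ι) (hj : Function.Injective j)
    (hσ : ∀ v, j (σ v) = B.mulVec (j v)) :
    ∃ (D : IndexTwoDatum (Multiplicative V)) (h : H),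
      D.conj = AddMonoidHom.toMultiplicative σ ∧ IsIndexTwoExtension D ι h := by
  obtain ⟨h, hh⟩ : ∃ h, h ∉ ι.range := by
    by_contra! hall
    have hindex := hι.index_eq
    rw [(Subgroup.eq_top_iff' _).2 hall, Subgroup.index_top] at hindex
    exact absurd hindex (by norm_num)
  refine (CommHNN.exists_isIndexTwoExtension hι.injective hι.index_eq hh fun v => ?_).imp
    fun D hD => ⟨h, hD⟩
  obtain ⟨w, hw, hconj⟩ := hι.conj h hh v.toAdd
  rw [hj (hw.trans (hσ v.toAdd).symm)] at hconj
  exact hconj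

end IndexTwoOvergroup

/-! ### Amalgamated products of extensions of index two -/

namespace Amalgam

variable {C H H' : Type} [Group C] [Group H] [Group H'] {f : C →* H} {f' : C →* H'}

theorem inl_eq_inr (c : C) : inl f f' (f c) = inr f f' (f' c) :=
  (Monoid.PushoutI.of_apply_eq_base (famHom f f') false c).trans
    (Monoid.PushoutI.of_apply_eq_base (famHom f f') true c).symm

theorem exists_lift {P : Type*} [Group P] (p : H →* P) (q : H' →* P)
    (hpq : ∀ c, p (f c) = q (f' c)) :
    ∃ Ψ : Amalgam f f' →* P, (∀ x, Ψ (inl f f' x) = p x) ∧ ∀ x, Ψ (inr f f' x) = q x := by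
  let F : ∀ b, Fam H H' b →* P := fun b => match b with
    | false => p
    | true => q
  have hF : ∀ b, (F b).comp (famHom f f' b) = p.comp f := fun b => match b with
    | false => rfl
    | true => MonoidHom.ext fun c => (hpq c).symm
  exact ⟨Monoid.PushoutI.lift F (p.comp f) hF,
    fun x => Monoid.PushoutI.lift_of F (p.comp f) hF (i := false) x,
    fun x => Monoid.PushoutI.lift_of F (p.comp f) hF (i := true) x⟩

theorem induction {p : Amalgam f f' → Prop} (hl : ∀ x, p (inl f f' x)) (hr : ∀ x, p (inr f f' x))
    (hmul : ∀ x y, p x → p y → p (x * y)) (x : Amalgam f f') : p x := by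
  induction x using Monoid.PushoutI.induction_on with
  | of i g => exact match i, g with
    | false, g => hl g
    | true, g => hr g
  | base c =>
    rw [← Monoid.PushoutI.of_apply_eq_base (famHom f f') false c]
    exact hl _
  | mul x y hx hy => exact hmul x y hx hy

end Amalgam

theorem ReducedForm.exists_word {ι : Type*} {G : ι → Type*} [∀ i, Group (G i)] {B : Type*}
    [Group B] {φ : ∀ i, B →* G i} {g : Monoid.PushoutI φ} {l : List ι}
    (hg : ReducedForm (fun i => (Monoid.PushoutI.of (φ := φ) i).range)
      (Monoid.PushoutI.base φ).range g l) :
    ∃ w : Monoid.CoprodI.Word G, Monoid.PushoutI.Reduced φ w ∧ w.toList.map Sigma.fst = l ∧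
      ∃ c ∈ (Monoid.PushoutI.base φ).range, g = Monoid.PushoutI.ofCoprodI w.prod * c := by
  induction hg with
  | @of_mem c hc =>
    exact ⟨.empty, fun g hg => by simp at hg, rfl, c, hc, by simp⟩
  | @cons i x g l hx hxC hl hg ih =>
    obtain ⟨w, hw, rfl, c, hc, rfl⟩ := ih
    obtain ⟨y, rfl⟩ := hx
    have hy : y ∉ (φ i).range := by
      rintro ⟨b, rfl⟩
      exact hxC ⟨b, (Monoid.PushoutI.of_apply_eq_base φ i b).symm⟩
    have hy1 : y ≠ 1 := by
      rintro rfl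
      exact hy (one_mem _)
    have hidx : w.fstIdx ≠ some i := by rwa [Monoid.CoprodI.Word.fstIdx, ← List.head?_map]
    refine ⟨.cons y w hidx hy1, ?_, rfl, c, hc, ?_⟩
    · intro g hg
      rcases List.mem_cons.1 hg with rfl | hg
      · exact hy
      · exact hw g hg
    · rw [Monoid.CoprodI.Word.prod_cons, map_mul, Monoid.PushoutI.ofCoprodI_of, mul_assoc]

theorem isAmalgam_pushoutI {ι : Type*} [Nonempty ι] {G : ι → Type*} [∀ i, Group (G i)] {B : Type*}
    [Group B] {φ : ∀ i, B →* G i} (hφ : ∀ i, Function.Injective (φ i)) :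
    IsAmalgam (fun i => (Monoid.PushoutI.of (φ := φ) i).range) (Monoid.PushoutI.base φ).range where
  le i := by
    rintro _ ⟨b, rfl⟩
    exact ⟨φ i b, Monoid.PushoutI.of_apply_eq_base φ i b⟩
  iSup_eq_top := by
    refine eq_top_iff.2 fun x _ => ?_
    induction x using Monoid.PushoutI.induction_on with
    | of i g => exact Subgroup.mem_iSup_of_mem i ⟨g, rfl⟩
    | base b =>
      obtain ⟨i⟩ := ‹Nonempty ι›
      exact Subgroup.mem_iSup_of_mem i ⟨φ i b, Monoid.PushoutI.of_apply_eq_base φ i b⟩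
    | mul x y hx hy => exact mul_mem (hx trivial) (hy trivial)
  eq_nil l hl := by
    obtain ⟨w, hw, rfl, c, hc, hwc⟩ := hl.exists_word
    have : Monoid.PushoutI.ofCoprodI w.prod ∈ (Monoid.PushoutI.base φ).range := by
      rw [eq_inv_of_mul_eq_one_left hwc.symm]
      exact inv_mem hc
    rw [hw.eq_empty_of_mem_range hφ this]
    rfl

section HNN

open IndexTwoDatum

variable {Λ M H H' : Type} [CommGroup Λ] [Group M] [Group H] [Group H'] {C B : Subgroup Λ}
  {φ : C ≃* B} {e : M ≃* C} {P : IndexTwoDatum Λ} {Q : IndexTwoDatum M}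

theorem coe_apply_eq_conj (hPQ : ∀ m, (e (Q.conj m) : Λ) = P.conj (φ (e m))) (m : M) :
    (φ (e m) : Λ) = P.conj (e (Q.conj m)) := by
  rw [hPQ, P.conj_conj_of_comm]

theorem conj_coe_eq_apply (hPQ : ∀ m, (e (Q.conj m) : Λ) = P.conj (φ (e m))) (m : M) :
    P.conj (e m) = φ (e (Q.conj m)) := by
  have hQ : Q.conj (Q.conj m) = m := by
    rw [Q.conj_conj, ← e.injective.eq_iff, map_mul, map_mul, map_inv, mul_inv_cancel_comm]
  rw [coe_apply_eq_conj hPQ, hQ]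

open HNNExtension in
/-- Conjugation of `HNNExtension Λ C B φ` by an element `u` that acts on `Λ` as prescribed by `P`
and satisfies `u * u = P.sq` and `(u⁻¹ * t) * (u⁻¹ * t) = Q.sq`. -/
def hnnConj (hPQ : ∀ m, (e (Q.conj m) : Λ) = P.conj (φ (e m))) :
    HNNExtension Λ C B φ →* HNNExtension Λ C B φ :=
  lift (of.comp P.conj) (of (P.sq * e Q.sq) * t⁻¹) fun c => by
    obtain ⟨m, rfl⟩ := e.surjective c
    rw [MonoidHom.comp_apply, MonoidHom.comp_apply, conj_coe_eq_apply hPQ, ← hPQ, mul_assoc,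
      ← of_mul_inv_t, ← mul_assoc, ← mul_assoc, ← map_mul, ← map_mul, mul_comm (_ : Λ)]

variable (hPQ : ∀ m, (e (Q.conj m) : Λ) = P.conj (φ (e m)))

theorem hnnConj_of (v : Λ) : hnnConj hPQ (HNNExtension.of v) = HNNExtension.of (P.conj v) :=
  HNNExtension.lift_of _ _ _ v

theorem hnnConj_t :
    hnnConj hPQ HNNExtension.t = HNNExtension.of (P.sq * e Q.sq) * HNNExtension.t⁻¹ :=
  HNNExtension.lift_t _ _ _

theorem hnnConj_hnnConj (g : HNNExtension Λ C B φ) :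
    hnnConj hPQ (hnnConj hPQ g) = HNNExtension.of P.sq * g * (HNNExtension.of P.sq)⁻¹ := by
  suffices h : (hnnConj hPQ).comp (hnnConj hPQ)
      = (MulAut.conj (HNNExtension.of P.sq)).toMonoidHom from DFunLike.congr_fun h g
  refine HNNExtension.hom_ext (MonoidHom.ext fun v => ?_) ?_
  · change hnnConj hPQ (hnnConj hPQ (HNNExtension.of v))
      = HNNExtension.of P.sq * HNNExtension.of v * (HNNExtension.of P.sq)⁻¹
    rw [hnnConj_of, hnnConj_of, P.conj_conj, map_mul, map_mul, map_inv]
  · change hnnConj hPQ (hnnConj hPQ HNNExtension.t)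
      = HNNExtension.of P.sq * HNNExtension.t * (HNNExtension.of P.sq)⁻¹
    rw [hnnConj_t, map_mul, map_inv, hnnConj_t, hnnConj_of, map_mul, P.conj_sq,
      conj_coe_eq_apply hPQ, Q.conj_sq, map_mul, map_mul, HNNExtension.equiv_eq_conj]
    group

/-- The datum of the extension of `HNNExtension Λ C B φ` by an element `u` as in `hnnConj`. -/
def hnnDatum : IndexTwoDatum (HNNExtension Λ C B φ) where
  conj := hnnConj hPQ
  sq := HNNExtension.of P.sq
  conj_sq := by rw [hnnConj_of, P.conj_sq]
  conj_conj := hnnConj_hnnConj hPQ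

variable {ι : Λ →* H} {h : H} {ι' : M →* H'} {h' : H'}

section

variable {X : Type*} [Group X] {κ : HNNExtension Λ C B φ →* X} {u : X}

theorem inv_mul_apply_t_mul_self (F : IsIndexTwoExtension (hnnDatum hPQ) κ u) :
    u⁻¹ * κ HNNExtension.t * (u⁻¹ * κ HNNExtension.t) = κ (HNNExtension.of (e Q.sq)) :=
  calc u⁻¹ * κ HNNExtension.t * (u⁻¹ * κ HNNExtension.t)
    _ = (u * u)⁻¹ * (u * κ HNNExtension.t * u⁻¹) * κ HNNExtension.t := by group
    _ = (κ (HNNExtension.of P.sq))⁻¹ * κ (hnnConj hPQ HNNExtension.t) * κ HNNExtension.t := by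
      rw [F.mul_self, F.conj]
      rfl
    _ = κ (HNNExtension.of (e Q.sq)) := by
      rw [hnnConj_t, map_mul HNNExtension.of, map_mul, map_mul, map_inv]
      group

theorem inv_mul_apply_t_mul_apply_mul_inv (F : IsIndexTwoExtension (hnnDatum hPQ) κ u) (m : M) :
    u⁻¹ * κ HNNExtension.t * κ (HNNExtension.of (e m)) * (u⁻¹ * κ HNNExtension.t)⁻¹
      = κ (HNNExtension.of (e (Q.conj m))) := by
  have hconj : u * κ (HNNExtension.of (e (Q.conj m))) * u⁻¹
      = κ HNNExtension.t * κ (HNNExtension.of (e m)) * (κ HNNExtension.t)⁻¹ := by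
    rw [F.conj, ← map_mul, ← map_inv, ← map_mul, ← HNNExtension.equiv_eq_conj,
      coe_apply_eq_conj hPQ, ← hnnConj_of hPQ]
    rfl
  calc _ = u⁻¹ * (κ HNNExtension.t * κ (HNNExtension.of (e m)) * (κ HNNExtension.t)⁻¹) * u := by
        group
    _ = κ (HNNExtension.of (e (Q.conj m))) := by
      rw [← hconj]
      group

theorem exists_amalgam_hom (F : IsIndexTwoExtension (hnnDatum hPQ) κ u)
    (E : IsIndexTwoExtension P ι h) (E' : IsIndexTwoExtension Q ι' h') :
    ∃ Ψ : Amalgam (ι.comp (C.subtype.comp e.toMonoidHom)) ι' →* X,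
      (∀ v, Ψ (Amalgam.inl _ _ (ι v)) = κ (HNNExtension.of v)) ∧ Ψ (Amalgam.inl _ _ h) = u ∧
      Ψ (Amalgam.inr _ _ h') = u⁻¹ * κ HNNExtension.t := by
  obtain ⟨p, hp, hph⟩ := E.exists_lift (κ.comp HNNExtension.of) u F.mul_self fun n =>
    (F.conj _).trans (congrArg κ (hnnConj_of hPQ n))
  obtain ⟨q, hq, hqh⟩ := E'.exists_lift
    (κ.comp (HNNExtension.of.comp (C.subtype.comp e.toMonoidHom))) (u⁻¹ * κ HNNExtension.t)
    (inv_mul_apply_t_mul_self hPQ F) (inv_mul_apply_t_mul_apply_mul_inv hPQ F)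
  obtain ⟨Ψ, hl, hr⟩ := Amalgam.exists_lift (f := ι.comp (C.subtype.comp e.toMonoidHom)) (f' := ι')
    p q fun m => (hp _).trans (hq m).symm
  exact ⟨Ψ, fun v => (hl _).trans (hp v), (hl h).trans hph, (hr h').trans hqh⟩

end

theorem inl_apply_coe_eq_inr (m : M) :
    Amalgam.inl (ι.comp (C.subtype.comp e.toMonoidHom)) ι' (ι (e m))
      = Amalgam.inr (ι.comp (C.subtype.comp e.toMonoidHom)) ι' (ι' m) :=
  Amalgam.inl_eq_inr m

/-- The homomorphism from an HNN-extension of `Λ` to the amalgam of two extensions of index two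
that extends the inclusion of `Λ` and sends the stable letter to the product of two elements, one
of either factor, that lie outside `Λ` and outside the amalgamated subgroup. -/
def hnnToAmalgam (E : IsIndexTwoExtension P ι h) (E' : IsIndexTwoExtension Q ι' h') :
    HNNExtension Λ C B φ →* Amalgam (ι.comp (C.subtype.comp e.toMonoidHom)) ι' :=
  HNNExtension.lift ((Amalgam.inl _ _).comp ι) (Amalgam.inl _ _ h * Amalgam.inr _ _ h') fun c => by
    obtain ⟨m, rfl⟩ := e.surjective c
    rw [MonoidHom.comp_apply, MonoidHom.comp_apply, inl_apply_coe_eq_inr, mul_assoc, ← map_mul,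
      E'.mul_apply, map_mul, ← inl_apply_coe_eq_inr, ← mul_assoc, ← map_mul, E.mul_apply,
      coe_apply_eq_conj hPQ, map_mul, mul_assoc]

variable (E : IsIndexTwoExtension P ι h) (E' : IsIndexTwoExtension Q ι' h')

theorem hnnToAmalgam_of (v : Λ) :
    hnnToAmalgam hPQ E E' (HNNExtension.of v) = Amalgam.inl _ _ (ι v) :=
  HNNExtension.lift_of _ _ _ v

theorem hnnToAmalgam_t :
    hnnToAmalgam hPQ E E' HNNExtension.t = Amalgam.inl _ _ h * Amalgam.inr _ _ h' :=
  HNNExtension.lift_t _ _ _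

theorem inl_mul_hnnToAmalgam_mul_inv (g : HNNExtension Λ C B φ) :
    Amalgam.inl _ _ h * hnnToAmalgam hPQ E E' g * (Amalgam.inl _ _ h)⁻¹
      = hnnToAmalgam hPQ E E' (hnnConj hPQ g) := by
  suffices hcomp : (MulAut.conj (Amalgam.inl _ _ h)).toMonoidHom.comp (hnnToAmalgam hPQ E E')
      = (hnnToAmalgam hPQ E E').comp (hnnConj hPQ) from DFunLike.congr_fun hcomp g
  refine HNNExtension.hom_ext (MonoidHom.ext fun v => ?_) ?_
  · change Amalgam.inl _ _ h * hnnToAmalgam hPQ E E' (HNNExtension.of v) * (Amalgam.inl _ _ h)⁻¹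
      = hnnToAmalgam hPQ E E' (hnnConj hPQ (HNNExtension.of v))
    rw [hnnConj_of, hnnToAmalgam_of, hnnToAmalgam_of, ← E.conj, map_mul, map_mul, map_inv]
  · change Amalgam.inl _ _ h * hnnToAmalgam hPQ E E' HNNExtension.t * (Amalgam.inl _ _ h)⁻¹
      = hnnToAmalgam hPQ E E' (hnnConj hPQ HNNExtension.t)
    rw [hnnConj_t, map_mul, map_inv, hnnToAmalgam_of, hnnToAmalgam_t, map_mul, map_mul,
      ← E.mul_self, inl_apply_coe_eq_inr, ← E'.mul_self, map_mul, map_mul]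
    group

theorem isIndexTwoExtension_hnnToAmalgam :
    IsIndexTwoExtension (hnnDatum hPQ) (hnnToAmalgam hPQ E E') (Amalgam.inl _ _ h) := by
  have F := Extension.isIndexTwoExtension (D := hnnDatum hPQ)
  obtain ⟨Φ, hΦ, hΦu⟩ := F.exists_lift (hnnToAmalgam hPQ E E') (Amalgam.inl _ _ h)
    (by rw [← map_mul, E.mul_self]; exact (hnnToAmalgam_of hPQ E E' _).symm)
    (inl_mul_hnnToAmalgam_mul_inv hPQ E E')
  obtain ⟨Ψ, hΨv, hΨh, hΨh'⟩ := exists_amalgam_hom hPQ F E E'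
  have hΨΦ : Ψ.comp Φ = MonoidHom.id _ := by
    have hof : (Ψ.comp (hnnToAmalgam hPQ E E')) = Extension.of _ :=
      HNNExtension.hom_ext
        (MonoidHom.ext fun v => (congrArg Ψ (hnnToAmalgam_of hPQ E E' v)).trans (hΨv v))
        (by rw [MonoidHom.comp_apply, hnnToAmalgam_t, map_mul, hΨh, hΨh', mul_inv_cancel_left])
    exact F.hom_ext (fun g => (congrArg Ψ (hΦ g)).trans (DFunLike.congr_fun hof g))
      ((congrArg Ψ hΦu).trans hΨh)
  have hΦΨl : (Φ.comp Ψ).comp (Amalgam.inl _ _) = Amalgam.inl _ _ :=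
    E.hom_ext (fun v => (congrArg Φ (hΨv v)).trans ((hΦ _).trans (hnnToAmalgam_of hPQ E E' v)))
      ((congrArg Φ hΨh).trans hΦu)
  have hΦΨr : (Φ.comp Ψ).comp (Amalgam.inr _ _) = Amalgam.inr _ _ := by
    refine E'.hom_ext (fun m => ?_) ?_
    · rw [MonoidHom.comp_apply, ← inl_apply_coe_eq_inr]
      exact DFunLike.congr_fun hΦΨl _
    · rw [MonoidHom.comp_apply, MonoidHom.comp_apply, hΨh', map_mul, map_inv, hΦ, hΦu,
        hnnToAmalgam_t, inv_mul_cancel_left]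
  have hΦΨ : Φ.comp Ψ = MonoidHom.id _ := MonoidHom.ext <| Amalgam.induction
    (DFunLike.congr_fun hΦΨl) (DFunLike.congr_fun hΦΨr) fun x y hx hy => by
      rw [map_mul, map_mul, hx, hy]
  have hcomp := F.of_mulEquiv (Φ.toMulEquiv Ψ hΨΦ hΦΨ)
  rwa [show (Φ.toMulEquiv Ψ hΨΦ hΦΨ).toMonoidHom.comp (Extension.of _) = hnnToAmalgam hPQ E E' from
    MonoidHom.ext hΦ, show Φ.toMulEquiv Ψ hΨΦ hΦΨ (Extension.root _) = _ from hΦu] at hcomp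

end HNN

/-! ### Invariant inner products -/

section InvariantNorm

variable {W E : Type*} [AddCommGroup W] [Module ℝ W] [NormedAddCommGroup E] [InnerProductSpace ℝ E]

theorem norm_mulVec_of_mem_orthogonalGroup {m : Type*} [Fintype m] [DecidableEq m]
    {U : Matrix m m ℝ} (hU : U ∈ Matrix.orthogonalGroup m ℝ) (y : m → ℝ) :
    ‖WithLp.toLp 2 (U.mulVec y)‖ = ‖WithLp.toLp 2 y‖ := by
  have norm_sq_eq (z : m → ℝ) : ‖WithLp.toLp 2 z‖ ^ 2 = z ⬝ᵥ z := by
    rw [EuclideanSpace.real_norm_sq_eq]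
    simp only [dotProduct, sq]
  refine (sq_eq_sq₀ (norm_nonneg _) (norm_nonneg _)).1 ?_
  rw [norm_sq_eq, norm_sq_eq, Matrix.dotProduct_mulVec, ← Matrix.mulVec_transpose,
    Matrix.mulVec_mulVec, (Matrix.mem_orthogonalGroup_iff' m ℝ).1 hU, Matrix.one_mulVec]

/-- The map `w ↦ (q w, q (R w))`. Pulling back the norm of `E × E` along it averages the norm
`‖q w‖` over the group generated by an involution `R`. -/
def averageMap (q : W →ₗ[ℝ] E) (R : W →ₗ[ℝ] W) : W →ₗ[ℝ] WithLp 2 (E × E) :=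
  (WithLp.linearEquiv 2 ℝ (E × E)).symm.toLinearMap.comp (q.prod (q.comp R))

variable {q : W →ₗ[ℝ] E} {R B : W →ₗ[ℝ] W}

theorem averageMap_injective (hq : Function.Injective q) :
    Function.Injective (averageMap q R) := fun _ _ hxy => hq (congrArg WithLp.fst hxy)

theorem norm_averageMap_eq_of_sq {v w : W}
    (h : ‖q v‖ ^ 2 + ‖q (R v)‖ ^ 2 = ‖q w‖ ^ 2 + ‖q (R w)‖ ^ 2) :
    ‖averageMap q R v‖ = ‖averageMap q R w‖ := by
  refine (sq_eq_sq₀ (norm_nonneg _) (norm_nonneg _)).1 ?_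
  rwa [WithLp.prod_norm_sq_eq_of_L2, WithLp.prod_norm_sq_eq_of_L2]

theorem norm_averageMap_involutive (hR : Function.Involutive R) (w : W) :
    ‖averageMap q R (R w)‖ = ‖averageMap q R w‖ :=
  norm_averageMap_eq_of_sq (by rw [hR, add_comm])

theorem norm_averageMap_of_norm_comp (hB : Function.Involutive B)
    (hRB : ∀ w, ‖q (R (B w))‖ = ‖q w‖) (w : W) :
    ‖averageMap q R (B w)‖ = ‖averageMap q R w‖ :=
  norm_averageMap_eq_of_sq (by rw [hRB, ← hRB (B w), hB, add_comm])

theorem exists_linearIsometryEquiv {E : Type*} [SeminormedAddCommGroup E] [NormedSpace ℝ E]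
    (Φ : W ≃ₗ[ℝ] E) (hB : Function.Involutive B)
    (hnorm : ∀ w, ‖Φ (B w)‖ = ‖Φ w‖) :
    ∃ U : E ≃ₗᵢ[ℝ] E, Function.Involutive U ∧ ∀ w, U (Φ w) = Φ (B w) := by
  let U : E ≃ₗ[ℝ] E := (Φ.symm.trans (LinearEquiv.ofInvolutive B hB)).trans Φ
  have hU (x : E) : U x = Φ (B (Φ.symm x)) := rfl
  refine ⟨⟨U, fun x => ?_⟩, fun x => ?_, fun w => ?_⟩
  · rw [hU, hnorm, LinearEquiv.apply_symm_apply]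
  · change U (U x) = x
    rw [hU, hU, LinearEquiv.symm_apply_apply, hB, LinearEquiv.apply_symm_apply]
  · change U (Φ w) = _
    rw [hU, LinearEquiv.symm_apply_apply]

theorem exists_equivariant_linearEquiv (hR : Function.Involutive R) (hB : Function.Involutive B)
    (hq : Function.Injective q) (hRB : ∀ w, ‖q (R (B w))‖ = ‖q w‖) :
    ∃ (F : Submodule ℝ (WithLp 2 (E × E))) (Φ : W ≃ₗ[ℝ] F) (U U' : F ≃ₗᵢ[ℝ] F),
      (Function.Involutive U ∧ ∀ w, U (Φ w) = Φ (R w)) ∧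
      (Function.Involutive U' ∧ ∀ w, U' (Φ w) = Φ (B w)) := by
  let Φ := LinearEquiv.ofInjective (averageMap q R) (averageMap_injective hq)
  obtain ⟨U, hU⟩ := exists_linearIsometryEquiv Φ hR (norm_averageMap_involutive hR)
  obtain ⟨U', hU'⟩ := exists_linearIsometryEquiv Φ hB (norm_averageMap_of_norm_comp hB hRB)
  exact ⟨_, Φ, U, U', hU, hU'⟩

end InvariantNorm

/-! ### Affine actions -/

section AffineAction

variable {E : Type*} [SeminormedAddCommGroup E]

/-- The action of `E` on itself by translations. -/
def translation (E : Type*) [SeminormedAddCommGroup E] : Multiplicative E →* (E ≃ᵢ E) where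
  toFun w := IsometryEquiv.addRight w.toAdd
  map_one' := IsometryEquiv.ext add_zero
  map_mul' v w := IsometryEquiv.ext fun x => by
    change x + (v.toAdd + w.toAdd) = x + w.toAdd + v.toAdd
    rw [add_assoc, add_comm v.toAdd]

theorem translation_apply (w : Multiplicative E) (x : E) : translation E w x = x + w.toAdd := rfl

theorem IsIndexTwoExtension.exists_affine_action [NormedSpace ℝ E] {N H : Type*}
    [Group N] [Group H] {D : IndexTwoDatum N} {ι : N →* H} {h : H} (hE : IsIndexTwoExtension D ι h)
    (β : N →* Multiplicative E) {U : E ≃ₗᵢ[ℝ] E} (hU : Function.Involutive U)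
    (hUβ : ∀ n, U (β n).toAdd = (β (D.conj n)).toAdd) :
    ∃ Ψ : H →* (E ≃ᵢ E), ∀ n, Ψ (ι n) = translation E (β n) := by
  -- `h * h = ι D.sq` forces the translation part of `h` to be half of that of `ι D.sq`.
  let w : E := (2⁻¹ : ℝ) • (β D.sq).toAdd
  have hw : U w = w := by rw [map_smul, hUβ, D.conj_sq]
  have hww : w + w = (β D.sq).toAdd := by
    rw [← two_smul ℝ, smul_smul, mul_inv_cancel₀ two_ne_zero, one_smul]
  let m : E ≃ᵢ E := U.toIsometryEquiv.trans (IsometryEquiv.addRight w)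
  have hm (x : E) : m x = U x + w := rfl
  obtain ⟨Ψ, hΨ, -⟩ := hE.exists_lift ((translation E).comp β) m
    (IsometryEquiv.ext fun x => by
      rw [IsometryEquiv.mul_apply, hm, hm, map_add, hU, hw, add_assoc, hww]
      rfl)
    (fun n => mul_inv_eq_iff_eq_mul.2 <| IsometryEquiv.ext fun x => by
      rw [IsometryEquiv.mul_apply, IsometryEquiv.mul_apply, MonoidHom.comp_apply,
        MonoidHom.comp_apply, translation_apply, translation_apply, hm, hm, map_add, hUβ,
        add_right_comm])
  exact ⟨Ψ, hΨ⟩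

end AffineAction

section GeometricAction

variable {M Λ E : Type*} [Group M] [Group Λ] {κ : M →* Λ}

theorem exists_isCompact_add_mem_of_index_ne_zero [SeminormedAddCommGroup E]
    {β : Λ →* Multiplicative E} (hκ : κ.range.index ≠ 0)
    (hcocompact : ∃ D : Set E, IsCompact D ∧ ∀ p, ∃ v, p + (β v).toAdd ∈ D) :
    ∃ D : Set E, IsCompact D ∧ ∀ p, ∃ m, p + (β (κ m)).toAdd ∈ D := by
  obtain ⟨D, hD, hDβ⟩ := hcocompact
  obtain ⟨F, hF, hFκ⟩ := exists_finite_transversal (S := (⊤ : Subgroup Λ)) (C := κ.range)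
    (by rwa [Subgroup.relIndex_top_right])
  refine ⟨⋃ r ∈ F, (· - (β r).toAdd) '' D, hF.isCompact_biUnion fun r _ =>
    hD.image (continuous_sub_right _), fun p => ?_⟩
  obtain ⟨v, hv⟩ := hDβ p
  obtain ⟨r, hr, m, hm⟩ := hFκ v trivial
  refine ⟨m, Set.mem_biUnion hr ⟨_, hv, ?_⟩⟩
  change p + _ - _ = _
  rw [hm, map_mul, map_inv, toAdd_mul, toAdd_inv, neg_add_eq_sub, add_sub_assoc]

theorem relIndex_range_comp_ne_zero {H K : Type*} [Group H] [Group K] {ι : Λ →* H}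
    (hι : Function.Injective ι) (hindex : ι.range.index ≠ 0) (hκ : κ.range.index ≠ 0) (k : H →* K) :
    ((k.comp (ι.comp κ)).range).relIndex k.range ≠ 0 := by
  have hfin : (ι.comp κ).range.index ≠ 0 := by
    rw [MonoidHom.range_comp, Subgroup.index_map_of_injective _ hι]
    exact mul_ne_zero hκ hindex
  rw [MonoidHom.range_comp, MonoidHom.range_eq_map k, Subgroup.relIndex_map_map, top_sup_eq,
    Subgroup.relIndex_top_right]
  exact ne_zero_of_dvd_ne_zero hfin (Subgroup.index_dvd_of_le le_sup_left)

variable {H H' : Type} [Group H] [Group H'] {M Λ E : Type} [Group M] [Group Λ]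
  [NormedAddCommGroup E] [InnerProductSpace ℝ E] {κ : M →* Λ} {β : Λ →* Multiplicative E}
  {P : IndexTwoDatum Λ} {Q : IndexTwoDatum M} {ι : Λ →* H} {h : H} {ι' : M →* H'} {h' : H'}

theorem Amalgam.exists_affine_action (hP : IsIndexTwoExtension P ι h)
    (hQ : IsIndexTwoExtension Q ι' h') {U U' : E ≃ₗᵢ[ℝ] E}
    (hU : Function.Involutive U) (hUβ : ∀ v, U (β v).toAdd = (β (P.conj v)).toAdd)
    (hU' : Function.Involutive U') (hUβ' : ∀ m, U' (β (κ m)).toAdd = (β (κ (Q.conj m))).toAdd) :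
    ∃ ρ : Amalgam (ι.comp κ) ι' →* (E ≃ᵢ E),
      ∀ m, ρ (Monoid.PushoutI.base _ m) = translation E (β (κ m)) := by
  obtain ⟨p, hp⟩ := hP.exists_affine_action β hU hUβ
  obtain ⟨q, hq⟩ := hQ.exists_affine_action (β.comp κ) hU' hUβ'
  obtain ⟨ρ, hρ, -⟩ := Amalgam.exists_lift (f := ι.comp κ) p q fun m => (hp _).trans (hq m).symm
  refine ⟨ρ, fun m => ?_⟩
  rw [← Monoid.PushoutI.of_apply_eq_base _ false]
  exact (hρ _).trans (hp _)

theorem Amalgam.relIndex_base_range_ne_zero (hP : IsIndexTwoExtension P ι h)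
    (hQ : IsIndexTwoExtension Q ι' h') (hκ : κ.range.index ≠ 0) (b : Bool) :
    (Monoid.PushoutI.base (famHom (ι.comp κ) ι')).range.relIndex
      (Monoid.PushoutI.of (φ := famHom (ι.comp κ) ι') b).range ≠ 0 := by
  rw [← Monoid.PushoutI.of_comp_eq_base (φ := famHom (ι.comp κ) ι') b]
  cases b with
  | false => exact relIndex_range_comp_ne_zero hP.injective (hP.index_eq.trans_ne two_ne_zero) hκ _
  | true =>
    refine relIndex_range_comp_ne_zero (κ := MonoidHom.id M) hQ.injective
      (hQ.index_eq.trans_ne two_ne_zero) ?_ _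
    rw [MonoidHom.range_eq_top_of_surjective _ Function.surjective_id, Subgroup.index_top]
    exact one_ne_zero

theorem Amalgam.isCAT0Group (hP : IsIndexTwoExtension P ι h) (hQ : IsIndexTwoExtension Q ι' h')
    (hκ : Function.Injective κ) (hκ' : κ.range.index ≠ 0) {U U' : E ≃ₗᵢ[ℝ] E}
    (hU : Function.Involutive U) (hUβ : ∀ v, U (β v).toAdd = (β (P.conj v)).toAdd)
    (hU' : Function.Involutive U') (hUβ' : ∀ m, U' (β (κ m)).toAdd = (β (κ (Q.conj m))).toAdd)
    (hproper : ∀ r : ℝ, {v | ‖(β v).toAdd‖ ≤ r}.Finite)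
    (hcocompact : ∃ D : Set E, IsCompact D ∧ ∀ p, ∃ v, p + (β v).toAdd ∈ D) :
    IsCAT0Group (Amalgam (ι.comp κ) ι') := by
  obtain ⟨ρ, hρ⟩ := Amalgam.exists_affine_action hP hQ hU hUβ hU' hUβ'
  let _ : MulAction (Amalgam (ι.comp κ) ι') E :=
    { smul := fun g x => ρ g x
      one_smul := fun x => congrArg (· x) (map_one ρ)
      mul_smul := fun g g' x => congrArg (· x) (map_mul ρ g g') }
  have : IsIsometricSMul (Amalgam (ι.comp κ) ι') E := ⟨fun g => (ρ g).isometry⟩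
  have hsmul (m : M) (p : E) : Monoid.PushoutI.base (famHom (ι.comp κ) ι') m • p
      = p + (β (κ m)).toAdd := congrArg (· p) (hρ m)
  have hinj : ∀ b, Function.Injective (famHom (ι.comp κ) ι' b) := fun b => match b with
    | false => hP.injective.comp hκ
    | true => hQ.injective
  refine (isAmalgam_pushoutI hinj).isCAT0Group (E := E)
    (Amalgam.relIndex_base_range_ne_zero hP hQ hκ') (fun p q r => ?_) ?_
  · refine (((hproper (r + dist p q)).preimage hκ.injOn).image
      (Monoid.PushoutI.base (famHom (ι.comp κ) ι'))).subset ?_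
    rintro _ ⟨⟨m, rfl⟩, hm⟩
    refine ⟨m, ?_, rfl⟩
    have htri := dist_triangle_right (p + (β (κ m)).toAdd) p q
    rw [dist_self_add_left] at htri
    rw [hsmul] at hm
    exact htri.trans (by linarith)
  · obtain ⟨D, hD, hDβ⟩ := exists_isCompact_add_mem_of_index_ne_zero hκ' hcocompact
    refine ⟨D, hD, fun p => ?_⟩
    obtain ⟨m, hm⟩ := hDβ p
    exact ⟨_, ⟨m, rfl⟩, by rwa [hsmul]⟩

end GeometricAction

/-! ### Lattices in `ℝⁿ` -/

section Lattice

variable {n : ℕ}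

theorem exists_nsmul_mem_interLattice (A : GL (Fin n) ℚ) :
    ∃ N : ℕ, N ≠ 0 ∧ ∀ v : Fin n → ℤ, N • v ∈ interLattice A := by
  obtain ⟨b, hb⟩ := IsLocalization.exist_integer_multiples_of_finite (nonZeroDivisors ℤ)
    fun i : Fin n × Fin n => (A : Matrix (Fin n) (Fin n) ℚ) i.1 i.2
  choose Z hZ using hb
  have hbv (v : Fin n → ℤ) : (b : ℤ) • v ∈ interLattice A := by
    refine ⟨fun i => ∑ j, Z (i, j) * v j, funext fun i => ?_⟩
    change ((∑ j, Z (i, j) * v j : ℤ) : ℚ)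
      = ∑ j, (A : Matrix (Fin n) (Fin n) ℚ) i j * (((b : ℤ) * v j : ℤ) : ℚ)
    push_cast
    refine Finset.sum_congr rfl fun j _ => ?_
    rw [show (Z (i, j) : ℚ) = (b : ℤ) • (A : Matrix (Fin n) (Fin n) ℚ) i j from hZ (i, j),
      zsmul_eq_mul, mul_left_comm, ← mul_assoc]
  refine ⟨(b : ℤ).natAbs, Int.natAbs_ne_zero.2 (nonZeroDivisors.coe_ne_zero b), fun v => ?_⟩
  rw [← natCast_zsmul, Int.natCast_natAbs, ← Int.sign_mul_self_eq_abs, mul_smul]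
  exact zsmul_mem (hbv v) _

theorem index_interLattice_ne_zero (A : GL (Fin n) ℚ) : (interLattice A).index ≠ 0 := by
  obtain ⟨N, hN, hNA⟩ := exists_nsmul_mem_interLattice A
  have hfin := AddSubgroup.finiteIndex_range_nsmulAddMonoidHom_of_fg (Fin n → ℤ) hN
  exact ne_zero_of_dvd_ne_zero hfin.index_ne_zero
    (AddSubgroup.index_dvd_of_le (by rintro _ ⟨v, rfl⟩; exact hNA v))

/-- The inclusion `ℤⁿ → ℝⁿ`. -/
def realVec (n : ℕ) : (Fin n → ℤ) →+ (Fin n → ℝ) :=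
  (Int.castAddHom ℝ).compLeft (Fin n)

theorem isClosedEmbedding_realVec (n : ℕ) : Topology.IsClosedEmbedding (realVec n) :=
  (Isometry.piMap _ fun _ => Real.isometry_intCast).isClosedEmbedding

theorem realVec_eq_mulVec {A : GL (Fin n) ℚ} {v w : Fin n → ℤ}
    (h : castVec n w = (A : Matrix (Fin n) (Fin n) ℚ).mulVec (castVec n v)) :
    realVec n w = (toReal A : Matrix (Fin n) (Fin n) ℝ).mulVec (realVec n v) := by
  have realVec_eq (u : Fin n → ℤ) : realVec n u = algebraMap ℚ ℝ ∘ castVec n u :=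
    funext fun i => (Rat.cast_intCast (u i)).symm
  rw [realVec_eq, realVec_eq, h]
  exact funext fun i => RingHom.map_mulVec (algebraMap ℚ ℝ) (A : Matrix (Fin n) (Fin n) ℚ) _ i

variable {E : Type*} [NormedAddCommGroup E] [NormedSpace ℝ E]

theorem finite_norm_realVec_le (Φ : (Fin n → ℝ) ≃ₗ[ℝ] E) (r : ℝ) :
    {v | ‖Φ (realVec n v)‖ ≤ r}.Finite := by
  have : FiniteDimensional ℝ E := Φ.finiteDimensional
  have : ProperSpace E := FiniteDimensional.proper_real E
  have hΦ := Φ.toContinuousLinearEquiv.toHomeomorph.isClosedEmbedding.comp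
    (isClosedEmbedding_realVec n)
  convert (hΦ.isCompact_preimage (isCompact_closedBall 0 r)).finite_of_discrete using 1
  ext v
  exact mem_closedBall_zero_iff.symm

theorem exists_isCompact_add_realVec_mem (Φ : (Fin n → ℝ) ≃ₗ[ℝ] E) :
    ∃ D : Set E, IsCompact D ∧ ∀ p, ∃ v, p + Φ (realVec n v) ∈ D := by
  refine ⟨Φ '' Set.Icc 0 1, isCompact_Icc.image Φ.toContinuousLinearEquiv.continuous, fun p => ?_⟩
  obtain ⟨y, rfl⟩ := Φ.surjective p
  have hfract (i : Fin n) : (y + realVec n fun i => -⌊y i⌋) i = Int.fract (y i) := by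
    change y i + ((-⌊y i⌋ : ℤ) : ℝ) = _
    rw [Int.cast_neg, ← sub_eq_add_neg, Int.self_sub_floor]
  refine ⟨fun i => -⌊y i⌋, y + realVec n fun i => -⌊y i⌋, ⟨fun i => ?_, fun i => ?_⟩, map_add _ _ _⟩
  · exact (Int.fract_nonneg _).trans_eq (hfract i).symm
  · exact (hfract i).trans_le (Int.fract_lt_one _).le

end Lattice

/-! ### The groups `G` and `K` -/

section Main

variable {n : ℕ}

theorem involutive_mulVec {m S : Type*} [Fintype m] [DecidableEq m] [CommRing S] {X : GL m S}
    (hX : X * X = 1) : Function.Involutive (X : Matrix m m S).mulVec := fun w => by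
  rw [Matrix.mulVec_mulVec, ← Units.val_mul, hX, Units.val_one, Matrix.one_mulVec]

/-- Multiplication by the integer matrix `R`. -/
def mulVecInt (R : GL (Fin n) ℤ) : (Fin n → ℤ) →+ (Fin n → ℤ) :=
  (Matrix.mulVecLin (R : Matrix (Fin n) (Fin n) ℤ)).toAddMonoidHom

theorem mulVecInt_mulVecInt {R : GL (Fin n) ℤ} (hR : R ^ 2 = 1) (v : Fin n → ℤ) :
    mulVecInt R (mulVecInt R v) = v :=
  involutive_mulVec ((sq R).symm.trans hR) v

theorem castVec_mulVecInt (R : GL (Fin n) ℤ) (v : Fin n → ℤ) :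
    castVec n (mulVecInt R v) = (toRat R : Matrix (Fin n) (Fin n) ℚ).mulVec (castVec n v) :=
  funext fun i => RingHom.map_mulVec (Int.castRingHom ℚ) (R : Matrix (Fin n) (Fin n) ℤ) v i

variable {A : GL (Fin n) ℚ} {L' : AddSubgroup (Fin n → ℤ)} {R : GL (Fin n) ℤ}

theorem toRat_mul_self (hR : R ^ 2 = 1) : toRat R * toRat R = 1 := by
  rw [toRat, ← map_mul, ← sq, hR, map_one]

theorem toRat_mul_mul_self (hRA : toRat R * A * toRat R = A⁻¹) :
    toRat R * A * (toRat R * A) = 1 := by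
  rw [← mul_assoc, hRA, inv_mul_cancel]

theorem toReal_mul (A B : GL (Fin n) ℚ) : toReal (A * B) = toReal A * toReal B :=
  map_mul (Matrix.GeneralLinearGroup.map (algebraMap ℚ ℝ)) A B

theorem toReal_mul_self (hA : A * A = 1) : toReal A * toReal A = 1 := by
  rw [← toReal_mul, hA, toReal, map_one]

section MulVecSub

variable (hL' : L' ≤ interLattice A) (hR : R ^ 2 = 1)
  (hRL : L'.map (mulVecInt R) = imageLattice A L')

include hR hRL in
theorem mulVecInt_latticeEquiv_mem (d : L') : mulVecInt R (latticeEquiv A L' hL' d) ∈ L' := by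
  obtain ⟨u, hu, hud⟩ := hRL.ge (latticeEquiv A L' hL' d).2
  rwa [← hud, mulVecInt_mulVecInt hR]

/-- Multiplication by `R A` on `L'`. -/
noncomputable def mulVecSub : L' →+ L' :=
  ((mulVecInt R).comp ((imageLattice A L').subtype.comp
    (latticeEquiv A L' hL').toAddMonoidHom)).codRestrict L' (mulVecInt_latticeEquiv_mem hL' hR hRL)

theorem coe_mulVecSub (d : L') :
    (mulVecSub hL' hR hRL d : Fin n → ℤ) = mulVecInt R (latticeEquiv A L' hL' d) := rfl

theorem castVec_mulVecSub (d : L') : castVec n (mulVecSub hL' hR hRL d) =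
    (toRat R * A : Matrix (Fin n) (Fin n) ℚ).mulVec (castVec n d) := by
  rw [coe_mulVecSub, castVec_mulVecInt, castVec_latticeEquiv, Matrix.mulVec_mulVec]

theorem mulVecSub_mulVecSub (hRA : toRat R * A * toRat R = A⁻¹) (d : L') :
    mulVecSub hL' hR hRL (mulVecSub hL' hR hRL d) = d := by
  refine Subtype.ext (castVec_injective n ?_)
  rw [castVec_mulVecSub, castVec_mulVecSub]
  exact involutive_mulVec (toRat_mul_mul_self hRA) _

end MulVecSub

theorem exists_isIndexTwoOvergroups (hL' : L' ≤ interLattice A) (hR : R ^ 2 = 1)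
    (hRL : L'.map (mulVecInt R) = imageLattice A L') (hRA : toRat R * A * toRat R = A⁻¹) :
    ∃ (H H' : Type) (_ : Group H) (_ : Group H')
      (ι : Multiplicative (Fin n → ℤ) →* H) (ι' : Multiplicative L' →* H'),
      IsIndexTwoOvergroup (castVec n) (toRat R : Matrix (Fin n) (Fin n) ℚ) ι ∧
      IsIndexTwoOvergroup ((castVec n).comp L'.subtype)
        (toRat R * A : Matrix (Fin n) (Fin n) ℚ) ι' := by
  obtain ⟨H, _, ι, hι⟩ := exists_isIndexTwoOvergroup (mulVecInt_mulVecInt hR) (castVec_mulVecInt R)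
  obtain ⟨H', _, ι', hι'⟩ := exists_isIndexTwoOvergroup (j := (castVec n).comp L'.subtype)
    (mulVecSub_mulVecSub hL' hR hRL hRA) (castVec_mulVecSub hL' hR hRL)
  exact ⟨H, H', _, _, ι, ι', hι, hι'⟩

theorem exists_equivariant_linearEquiv_of_conj_mem_orthogonalGroup (hR : R ^ 2 = 1)
    (hRA : toRat R * A * toRat R = A⁻¹) {P : GL (Fin n) ℝ}
    (hP : ((P * toReal A * P⁻¹ : GL (Fin n) ℝ) : Matrix (Fin n) (Fin n) ℝ)
      ∈ Matrix.orthogonalGroup (Fin n) ℝ) :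
    ∃ (E : Type) (_ : NormedAddCommGroup E) (_ : InnerProductSpace ℝ E)
      (Φ : (Fin n → ℝ) ≃ₗ[ℝ] E) (U U' : E ≃ₗᵢ[ℝ] E),
      (Function.Involutive U ∧
        ∀ w, U (Φ w) = Φ ((toReal (toRat R) : Matrix (Fin n) (Fin n) ℝ).mulVec w)) ∧
      (Function.Involutive U' ∧
        ∀ w, U' (Φ w) = Φ ((toReal (toRat R * A) : Matrix (Fin n) (Fin n) ℝ).mulVec w)) := by
  let q : (Fin n → ℝ) →ₗ[ℝ] EuclideanSpace ℝ (Fin n) :=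
    (WithLp.linearEquiv 2 ℝ (Fin n → ℝ)).symm.toLinearMap.comp
      (Matrix.mulVecLin (P : Matrix (Fin n) (Fin n) ℝ))
  have hq : Function.Injective q := (WithLp.linearEquiv 2 ℝ (Fin n → ℝ)).symm.injective.comp
    (Matrix.mulVec_injective_of_isUnit P.isUnit)
  have hqA (w : Fin n → ℝ) :
      ‖q ((toReal A : Matrix (Fin n) (Fin n) ℝ).mulVec w)‖ = ‖q w‖ := by
    have hPw := norm_mulVec_of_mem_orthogonalGroup hP ((P : Matrix (Fin n) (Fin n) ℝ).mulVec w)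
    rw [Matrix.mulVec_mulVec, ← Units.val_mul, inv_mul_cancel_right, Units.val_mul,
      ← Matrix.mulVec_mulVec] at hPw
    exact hPw
  obtain ⟨F, Φ, U, U', hU, hU'⟩ := exists_equivariant_linearEquiv
    (R := Matrix.mulVecLin (toReal (toRat R) : Matrix (Fin n) (Fin n) ℝ))
    (B := Matrix.mulVecLin (toReal (toRat R * A) : Matrix (Fin n) (Fin n) ℝ))
    (involutive_mulVec (toReal_mul_self (toRat_mul_self hR)))
    (involutive_mulVec (toReal_mul_self (toRat_mul_mul_self hRA))) hq fun w => by
      rw [Matrix.mulVecLin_apply, Matrix.mulVecLin_apply, Matrix.mulVec_mulVec, ← Units.val_mul,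
        ← toReal_mul, ← mul_assoc, toRat_mul_self hR, one_mul, hqA]
  exact ⟨F, inferInstance, inferInstance, Φ, U, U', hU, hU'⟩

variable {H H' : Type} [Group H] [Group H'] {ι : Multiplicative (Fin n → ℤ) →* H}
  {ι' : Multiplicative L' →* H'}

theorem exists_isIndexTwoExtensions (hL' : L' ≤ interLattice A) (hR : R ^ 2 = 1)
    (hRL : L'.map (mulVecInt R) = imageLattice A L')
    (hι : IsIndexTwoOvergroup (castVec n) (toRat R : Matrix (Fin n) (Fin n) ℚ) ι)
    (hι' : IsIndexTwoOvergroup ((castVec n).comp L'.subtype)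
      (toRat R * A : Matrix (Fin n) (Fin n) ℚ) ι') :
    (∃ D h, D.conj = AddMonoidHom.toMultiplicative (mulVecInt R) ∧ IsIndexTwoExtension D ι h) ∧
    ∃ D' h', D'.conj = AddMonoidHom.toMultiplicative (mulVecSub hL' hR hRL) ∧
      IsIndexTwoExtension D' ι' h' :=
  ⟨hι.exists_isIndexTwoExtension (castVec_injective n) (castVec_mulVecInt R),
    hι'.exists_isIndexTwoExtension ((castVec_injective n).comp L'.subtype_injective)
      (castVec_mulVecSub hL' hR hRL)⟩

/-- The tautological isomorphism between the two ways of writing `L'` multiplicatively. -/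
def toSubgroupEquiv (L' : AddSubgroup (Fin n → ℤ)) :
    Multiplicative L' ≃* AddSubgroup.toSubgroup L' where
  toFun d := ⟨Multiplicative.ofAdd d.toAdd.1, d.toAdd.2⟩
  invFun c := Multiplicative.ofAdd ⟨c.1.toAdd, c.2⟩
  map_mul' _ _ := rfl

theorem exists_hom_of_isIndexTwoOvergroup (hL' : L' ≤ interLattice A) (hR : R ^ 2 = 1)
    (hRL : L'.map (mulVecInt R) = imageLattice A L')
    (hι : IsIndexTwoOvergroup (castVec n) (toRat R : Matrix (Fin n) (Fin n) ℚ) ι)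
    (hι' : IsIndexTwoOvergroup ((castVec n).comp L'.subtype)
      (toRat R * A : Matrix (Fin n) (Fin n) ℚ) ι') :
    ∃ f : G A L' hL' →* K ι ι', Function.Injective f ∧ f.range.index = 2 ∧
      ∀ v : Multiplicative (Fin n → ℤ), f (HNNExtension.of v) = Amalgam.inl _ _ (ι v) := by
  obtain ⟨⟨D, h, hD, hE⟩, D', h', hD', hE'⟩ := exists_isIndexTwoExtensions hL' hR hRL hι hι'
  have hDD' (m : Multiplicative L') : (toSubgroupEquiv L' (D'.conj m) : Multiplicative (Fin n → ℤ))
      = D.conj (stableEquiv A L' hL' (toSubgroupEquiv L' m)) := by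
    rw [hD, hD']
    rfl
  have hf := isIndexTwoExtension_hnnToAmalgam hDD' hE hE'
  exact ⟨hnnToAmalgam hDD' hE hE', hf.injective, hf.index_eq, hnnToAmalgam_of hDD' hE hE'⟩

theorem isCAT0Group_K (hL' : L' ≤ interLattice A) (hfin : L'.relIndex (interLattice A) ≠ 0)
    (hR : R ^ 2 = 1) (hRA : toRat R * A * toRat R = A⁻¹)
    (hRL : L'.map (mulVecInt R) = imageLattice A L')
    (hι : IsIndexTwoOvergroup (castVec n) (toRat R : Matrix (Fin n) (Fin n) ℚ) ι)
    (hι' : IsIndexTwoOvergroup ((castVec n).comp L'.subtype)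
      (toRat R * A : Matrix (Fin n) (Fin n) ℚ) ι') {P : GL (Fin n) ℝ}
    (hP : ((P * toReal A * P⁻¹ : GL (Fin n) ℝ) : Matrix (Fin n) (Fin n) ℝ)
      ∈ Matrix.orthogonalGroup (Fin n) ℝ) : IsCAT0Group (K ι ι') := by
  obtain ⟨⟨D, h, hD, hE⟩, D', h', hD', hE'⟩ := exists_isIndexTwoExtensions hL' hR hRL hι hι'
  obtain ⟨E, _, _, Φ, U, U', ⟨hU, hUΦ⟩, hU', hUΦ'⟩ :=
    exists_equivariant_linearEquiv_of_conj_mem_orthogonalGroup hR hRA hP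
  let κ : Multiplicative L' →* Multiplicative (Fin n → ℤ) :=
    AddMonoidHom.toMultiplicative L'.subtype
  let β : Multiplicative (Fin n → ℤ) →* Multiplicative E :=
    AddMonoidHom.toMultiplicative (Φ.toLinearMap.toAddMonoidHom.comp (realVec n))
  have hindex : κ.range.index ≠ 0 := by
    have hL'index : L'.index ≠ 0 := by
      rw [← AddSubgroup.relIndex_mul_index hL']
      exact mul_ne_zero hfin (index_interLattice_ne_zero A)
    rwa [← L'.range_subtype] at hL'index
  have hUβ (v : Multiplicative (Fin n → ℤ)) : U (β v).toAdd = (β (D.conj v)).toAdd := by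
    rw [hD]
    exact (hUΦ _).trans (congrArg Φ (realVec_eq_mulVec (castVec_mulVecInt R v.toAdd)).symm)
  have hUβ' (d : Multiplicative L') : U' (β (κ d)).toAdd = (β (κ (D'.conj d))).toAdd := by
    rw [hD']
    exact (hUΦ' _).trans (congrArg Φ (realVec_eq_mulVec (A := toRat R * A)
      (castVec_mulVecSub hL' hR hRL d.toAdd)).symm)
  exact Amalgam.isCAT0Group hE hE' L'.subtype_injective hindex hU hUβ hU' hUβ'
    (finite_norm_realVec_le Φ) (exists_isCompact_add_realVec_mem Φ)

end Main

end CommHNN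

theorem mainTheorem9_general (n : ℕ) (A : GL (Fin n) ℚ) (L' : AddSubgroup (Fin n → ℤ))
    (hL' : L' ≤ CommHNN.interLattice A) (R : GL (Fin n) ℤ) (hR : R ^ 2 = 1)
    (hRA : CommHNN.toRat R * A * CommHNN.toRat R = A⁻¹)
    (hRL : L'.map (Matrix.mulVecLin (R : Matrix (Fin n) (Fin n) ℤ)).toAddMonoidHom
      = CommHNN.imageLattice A L') :
    (∃ (H H' : Type) (_ : Group H) (_ : Group H')
      (ι : Multiplicative (Fin n → ℤ) →* H) (ι' : Multiplicative L' →* H'),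
      CommHNN.IsIndexTwoOvergroup (CommHNN.castVec n)
        (CommHNN.toRat R : Matrix (Fin n) (Fin n) ℚ) ι ∧
      CommHNN.IsIndexTwoOvergroup ((CommHNN.castVec n).comp L'.subtype)
        (CommHNN.toRat R * A : Matrix (Fin n) (Fin n) ℚ) ι') ∧
    ∀ (H H' : Type) [Group H] [Group H']
      (ι : Multiplicative (Fin n → ℤ) →* H) (ι' : Multiplicative L' →* H'),
      CommHNN.IsIndexTwoOvergroup (CommHNN.castVec n)
        (CommHNN.toRat R : Matrix (Fin n) (Fin n) ℚ) ι →
      CommHNN.IsIndexTwoOvergroup ((CommHNN.castVec n).comp L'.subtype)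
        (CommHNN.toRat R * A : Matrix (Fin n) (Fin n) ℚ) ι' →
      (∃ f : CommHNN.G A L' hL' →* CommHNN.K ι ι',
        Function.Injective f ∧ f.range.index = 2 ∧
        ∀ v : Multiplicative (Fin n → ℤ),
          f (HNNExtension.of v) = CommHNN.Amalgam.inl _ _ (ι v)) ∧
      (L'.relIndex (CommHNN.interLattice A) ≠ 0 →
        (∃ P : GL (Fin n) ℝ,
          ((P * CommHNN.toReal A * P⁻¹ : GL (Fin n) ℝ) : Matrix (Fin n) (Fin n) ℝ)
            ∈ Matrix.orthogonalGroup (Fin n) ℝ) →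
        CommHNN.IsCAT0Group (CommHNN.K ι ι')) :=
  ⟨CommHNN.exists_isIndexTwoOvergroups hL' hR hRL hRA, fun _ _ _ _ _ _ hι hι' =>
    ⟨CommHNN.exists_hom_of_isIndexTwoOvergroup hL' hR hRL hι hι', fun hfin ⟨_, hP⟩ =>
      CommHNN.isCAT0Group_K hL' hfin hR hRA hRL hι hι' hP⟩⟩

theorem mainTheorem9 (n : ℕ) (A : GL (Fin n) ℚ) (L' : AddSubgroup (Fin n → ℤ))
    (hL' : L' ≤ CommHNN.interLattice A) (hfin : L'.relIndex (CommHNN.interLattice A) ≠ 0)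
    (R : GL (Fin n) ℤ) (hR : R ^ 2 = 1)
    (hRA : CommHNN.toRat R * A * CommHNN.toRat R = A⁻¹)
    (hRL : L'.map (Matrix.mulVecLin (R : Matrix (Fin n) (Fin n) ℤ)).toAddMonoidHom
      = CommHNN.imageLattice A L') :
    (∃ (H H' : Type) (_ : Group H) (_ : Group H')
      (ι : Multiplicative (Fin n → ℤ) →* H) (ι' : Multiplicative L' →* H'),
      CommHNN.IsIndexTwoOvergroup (CommHNN.castVec n)
        (CommHNN.toRat R : Matrix (Fin n) (Fin n) ℚ) ι ∧
      CommHNN.IsIndexTwoOvergroup ((CommHNN.castVec n).comp L'.subtype)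
        (CommHNN.toRat R * A : Matrix (Fin n) (Fin n) ℚ) ι') ∧
    ∀ (H H' : Type) [Group H] [Group H']
      (ι : Multiplicative (Fin n → ℤ) →* H) (ι' : Multiplicative L' →* H'),
      CommHNN.IsIndexTwoOvergroup (CommHNN.castVec n)
        (CommHNN.toRat R : Matrix (Fin n) (Fin n) ℚ) ι →
      CommHNN.IsIndexTwoOvergroup ((CommHNN.castVec n).comp L'.subtype)
        (CommHNN.toRat R * A : Matrix (Fin n) (Fin n) ℚ) ι' →
      (∃ f : CommHNN.G A L' hL' →* CommHNN.K ι ι',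
        Function.Injective f ∧ f.range.index = 2 ∧
        ∀ v : Multiplicative (Fin n → ℤ),
          f (HNNExtension.of v) = CommHNN.Amalgam.inl _ _ (ι v)) ∧
      (n = 2 →
        (∃ P : GL (Fin n) ℝ,
          ((P * CommHNN.toReal A * P⁻¹ : GL (Fin n) ℝ) : Matrix (Fin n) (Fin n) ℝ)
            ∈ Matrix.specialOrthogonalGroup (Fin n) ℝ) →
        CommHNN.IsCAT0Group (CommHNN.K ι ι')) := by
  obtain ⟨hex, hall⟩ := mainTheorem9_general n A L' hL' R hR hRA hRL
  exact ⟨hex, fun H H' _ _ ι ι' hι hι' => (hall H H' ι ι' hι hι').imp_right fun hCAT0 _ ⟨P, hP⟩ =>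
    hCAT0 hfin ⟨P, (Matrix.mem_specialOrthogonalGroup_iff.1 hP).1⟩⟩
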